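/- **Conventions.** A $*$-probability space $(\mathcal A,\varphi)$ is a unital $*$-algebra $\mathcal A$ over $\mathbb C$ with a linear functional $\varphi:\mathcal A\to\mathbb C$ such that $\varphi(1)=1$ and $\varphi(a^*a)\ge 0$ for all $a\in\mathcal A$; it is tracial if $\varphi(ab)=\varphi(ba)$ for all $a,b$. Its free cumulants are $$\kappa_n(a_1,\dots,a_n)=\sum_{\pi\in NC(n)}\mathrm{Moeb}(\pi,1_n)\prod_{\{i_1<\dots<i_m\}\in\pi}\varphi(a_{i_1}\cdots a_{i_m}),$$ where $NC(n)$ is the lattice of non-crossing partitions of $\{1,\dots,n\}$ ordered by reverse refinement ($\pi\le\rho$ if every block of $\rho$ is a union of blocks of $\pi$), $1_n$ is the one-block partition, and $\mathrm{Moeb}$ is the Möbius function of $NC(n)$. Strings are elements $\omega=(\omega(1),\dots,\omega(n))\in\{1,*\}^n$, $n \geq 1$, and $a^{1}:=a$, while $a^{*}$ is the adjoint of $a$. A free unitary Brownian motion is a family $(u_t)_{t\ge0}$, each $u_t$ being a unitary element of a tracial $*$-probability space $(\mathcal A_t,\varphi_t)$ with $\varphi_t(u_t)=e^{-t/2}$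 and such that $v_t:=e^{t/2}u_t$ has $S$-transform $S_{v_t}(z)=e^{tz}$. (Here $S_a(z)=\chi(z)(1+z)/z$ for $\varphi(a)\neq 0$, where $\chi$ is the inverse under composition of the formal power series $\psi_a(z)=\sum_{n\ge1}\varphi(a^n)z^n$.) For $n\ge1$ put $Q_n(x)=-\sum_{j=0}^{n-1}\frac{(-n)^{j-1}}{j!}\binom{n}{j+1}x^j$. For a string $\omega$ with $k$ symbols $1$ and $\ell$ symbols $*$ put $M_\omega(x,y)=Q_{|k-\ell|}(x)\,y^{|k-\ell|}$ if $k\ne\ell$, and $M_\omega=1$ if $k=\ell$. For $\omega\in\{1,*\}^n$ let $$Z_\omega:=\sum_{\pi\in NC(n)}\mathrm{Moeb}(\pi,1_n)\prod_{V\in\pi}M_{\omega|V}\in\mathbb Q[x,y],$$ where $\omega|V$ is the restriction of $\omega$ to the positions in $V$. **Statement.** (1) Let $(\mathcal A,\varphi)$ be a $*$-probability space, let $u\in\mathcal A$ be unitary, and let $\omega\in\{1,*\}^n$ with $n\ge3$, $\omega(1)=1$ and $\omega(n)=*$. Then $$\kappa_n\bigl(u^{\omega(1)},\dots,u^{\omega(n)}\bigr)=-\sum_{m=1}^{n-1}\kappa_m\bigl(u^{\omega(1)},\dots,u^{\omega(m)}\bigr)\,\kappa_{n-m}\bigl(u^{\omega(m+1)},\dots,u^{\omega(n)}\bigr).$$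 (2) Let $(u_t)_{t\ge0}$ be a free unitary Brownian motion and let $\omega\in\{1,*\}^n$, $n\ge1$. Then $Z_\omega$ is the unique polynomial in $\mathbb Q[x,y]$ such that $$\kappa_n\bigl(u_t^{\omega(1)},\dots,u_t^{\omega(n)}\bigr)=Z_\omega(t,e^{-t/2})\qquad\text{for all }t\in[0,\infty).$$ (3) Let $\omega\in\{1,*\}^n$ with $n\ge3$, $\omega(1)=1$ and $\omega(n)=*$. Then, as polynomials in two variables, $$Z_\omega=-\sum_{m=1}^{n-1}Z_{(\omega(1),\dots,\omega(m))}\cdot Z_{(\omega(m+1),\dots,\omega(n))}.$$ -/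

import Mathlib

open scoped NNReal

noncomputable section

namespace FreeCumulants

/-! ### Non-crossing partitions -/

/-- A partition of `{0, …, n-1}` is non-crossing if there are no `a < b < c < d` with `a, c` in
one block and `b, d` in a different block. -/
def IsNonCrossing {n : ℕ} (π : Finpartition (Finset.univ : Finset (Fin n))) : Prop :=
  ∀ V ∈ π.parts, ∀ W ∈ π.parts, ∀ a b c d : Fin n,
    a < b → b < c → c < d → a ∈ V → c ∈ V → b ∈ W → d ∈ W → V = W

/-- The set `NC(n)` of non-crossing partitions of an `n`-element totally ordered set. -/
def NC (n : ℕ) : Type :=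
  {π : Finpartition (Finset.univ : Finset (Fin n)) // IsNonCrossing π}

/-- Reverse refinement order: `π ≤ ρ` iff every block of `π` is contained in a block of `ρ`. -/
instance (n : ℕ) : PartialOrder (NC n) := Subtype.partialOrder _

instance (n : ℕ) : Fintype (NC n) := by
  classical exact Subtype.fintype _

instance (n : ℕ) : DecidableEq (NC n) := Classical.decEq _

instance (n : ℕ) : LocallyFiniteOrder (NC n) := by
  classical exact Fintype.toLocallyFiniteOrder

theorem isNonCrossing_top (n : ℕ) :
    IsNonCrossing (⊤ : Finpartition (Finset.univ : Finset (Fin n))) := by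
  intro V hV W hW a b c d _ _ _ _ _ _ _
  have hV' := Finset.mem_singleton.1 (Finpartition.parts_top_subset _ hV)
  have hW' := Finset.mem_singleton.1 (Finpartition.parts_top_subset _ hW)
  rw [hV', hW']

/-- The largest element `1_n` of `NC(n)` (a single block when `n ≥ 1`). -/
instance (n : ℕ) : OrderTop (NC n) where
  top := ⟨⊤, isNonCrossing_top n⟩
  le_top π := (le_top : π.1 ≤ ⊤)

/-- The Möbius function `Moeb(π, 1_n)` of the poset `NC(n)`. -/
def moebTop {n : ℕ} (π : NC n) : ℤ := IncidenceAlgebra.mu ℤ π ⊤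

/-- The restriction `(x_1, …, x_n) | V` of a tuple to a set `V` of positions. -/
def restrict {X : Type*} (x : List X) (V : Finset (Fin x.length)) : List X :=
  (V.sort (· ≤ ·)).map x.get

/-- The expression `∑_{π ∈ NC(n)} Moeb(π, 1_n) ∏_{V ∈ π} M(x | V)` for a tuple `x` of length `n`
and a function `M` on tuples. -/
def moebiusSum {X K : Type*} [CommRing K] (M : List X → K) (x : List X) : K :=
  ∑ π : NC x.length, (moebTop π : K) * ∏ V ∈ π.1.parts, M (restrict x V)

/-! ### `*`-probability spaces and free cumulants -/

section Probability

variable {A : Type*} [Ring A] [Algebra ℂ A]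

/-- The free cumulant `κ_n(a_1, …, a_n)` for the expectation functional `φ`, the tuple
`(a_1, …, a_n)` being given as a list. The underlying moments are
`φ_m(b_1, …, b_m) = φ(b_1 ⋯ b_m)`. -/
def freeCumulant (φ : A →ₗ[ℂ] ℂ) (a : List A) : ℂ :=
  moebiusSum (fun b : List A => φ b.prod) a

/-- `φ` makes the unital `*`-algebra `A` a `*`-probability space: `φ(1) = 1` and
`φ(a* a) ≥ 0` for all `a`. -/
structure IsStarProbabilitySpace [StarRing A] (φ : A →ₗ[ℂ] ℂ) : Prop where
  map_one : φ 1 = 1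
  im_eq_zero : ∀ a : A, (φ (star a * a)).im = 0
  re_nonneg : ∀ a : A, 0 ≤ (φ (star a * a)).re

/-- The moment series `ψ_a(z) = ∑_{n ≥ 1} φ(a^n) z^n`. -/
def momentSeries (φ : A →ₗ[ℂ] ℂ) (a : A) : PowerSeries ℂ :=
  PowerSeries.mk fun n => if n = 0 then 0 else φ (a ^ n)

/-- The power series `S` is the `S`-transform of `a`, where `φ(a) ≠ 0`: if `χ` is the inverse of
`ψ_a` under composition, then `S(z) = χ(z) (1 + z) / z`. -/
def HasSTransform (φ : A →ₗ[ℂ] ℂ) (a : A) (S : PowerSeries ℂ) : Prop :=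
  φ a ≠ 0 ∧ ∃ χ : PowerSeries ℂ, PowerSeries.constantCoeff χ = 0 ∧
    (momentSeries φ a).subst χ = PowerSeries.X ∧
    PowerSeries.X * S = χ * (1 + PowerSeries.X)

end Probability

/-- `(u_t)_{t ≥ 0}` is a free unitary Brownian motion: each `u_t` is a unitary in a tracial
`*`-probability space `(A_t, φ_t)`, with `φ_t(u_t) = e^{-t/2}`, and `e^{t/2} u_t` has
`S`-transform `e^{tz}`. -/
structure IsFreeUnitaryBrownianMotion {A : ℝ≥0 → Type*} [∀ t, Ring (A t)]
    [∀ t, Algebra ℂ (A t)] [∀ t, StarRing (A t)]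
    (φ : ∀ t, A t →ₗ[ℂ] ℂ) (u : ∀ t, A t) : Prop where
  isStarProbabilitySpace : ∀ t, IsStarProbabilitySpace (φ t)
  tracial : ∀ t, ∀ a b : A t, φ t (a * b) = φ t (b * a)
  unitary : ∀ t, u t ∈ unitary (A t)
  expectation : ∀ t, φ t (u t) = (Real.exp (-(t : ℝ) / 2) : ℂ)
  sTransform : ∀ t, HasSTransform (φ t) ((Real.exp ((t : ℝ) / 2) : ℂ) • u t)
    (PowerSeries.rescale (((t : ℝ) : ℂ)) (PowerSeries.exp ℂ))

/-! ### Strings in the symbols `1` and `*` -/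

/-- The two symbols `1` and `*`. -/
inductive Symb : Type
  | one : Symb
  | star : Symb

instance : DecidableEq Symb := fun a b =>
  match a, b with
  | .one, .one => isTrue rfl
  | .star, .star => isTrue rfl
  | .one, .star => isFalse (fun h => Symb.noConfusion h)
  | .star, .one => isFalse (fun h => Symb.noConfusion h)

/-- `a^1 = a` and `a^* = star a`. -/
def symbPow {A : Type*} [Star A] (a : A) : Symb → A
  | .one => a
  | .star => star a

/-- The tuple `(a^{ω(1)}, …, a^{ω(n)})`. -/
def stringPow {A : Type*} [Star A] (a : A) (ω : List Symb) : List A :=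
  ω.map (symbPow a)

/-! ### The polynomials `Z_ω` in `ℚ[x, y]`, where `x = X 0` and `y = X 1` -/

/-- `Q_n(x) = - ∑_{j=0}^{n-1} ((-n)^{j-1} / j!) (n choose j+1) x^j`, for `n ≥ 1`. -/
def polyQ (n : ℕ) : MvPolynomial (Fin 2) ℚ :=
  -∑ j ∈ Finset.range n,
    MvPolynomial.C ((-(n : ℚ)) ^ ((j : ℤ) - 1) / (j.factorial : ℚ) * (n.choose (j + 1) : ℚ)) *
      MvPolynomial.X 0 ^ j

/-- `M_ω = Q_{|k-l|}(x) y^{|k-l|}` if `ω` has `k` symbols `1` and `l ≠ k` symbols `*`, and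
`M_ω = 1` if `k = l`. -/
def polyM (ω : List Symb) : MvPolynomial (Fin 2) ℚ :=
  if ω.count Symb.one = ω.count Symb.star then 1
  else
    polyQ (((ω.count Symb.one : ℤ) - (ω.count Symb.star : ℤ)).natAbs) *
      MvPolynomial.X 1 ^ ((ω.count Symb.one : ℤ) - (ω.count Symb.star : ℤ)).natAbs

/-- `Z_ω = ∑_{π ∈ NC(n)} Moeb(π, 1_n) ∏_{V ∈ π} M_{ω | V}`. -/
def polyZ (ω : List Symb) : MvPolynomial (Fin 2) ℚ := moebiusSum polyM ω

end FreeCumulants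

end

/-! In a word in a unitary `u` and its adjoint the adjoint is the inverse, so a moment depends only
on the total weight (number of `1` minus number of `*`). Hence deleting a first letter `1` together
with a last letter `*` changes no moment. The recursion is a formal consequence of this and of the
value 1 at weight 0, so it holds equally for `u` and for the polynomials `Z_ω`; both are instances
of `moebiusSum_weight_recursion`.

Let `a`, `b` be the extreme positions of `S`, and expand the moment of `S` over non-crossing
partitions (`moment_eq_sum_moebiusSum`). If `a` and `b` lie in different blocks, the first block
lies entirely below the second, and merging them leaves a non-crossing partition. Grouping by the
block `V` that contains both after merging, each `V` carries the weight `intervalSplitSum`: its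
cumulant plus all products of two cumulants obtained by cutting `V` once. The partitions with `V =
{a, b}` already sum to the moment of `S` without `a` and `b`, which is the moment of `S`. By
induction on `S` the weight is therefore 1 on `{a, b}` and 0 on every larger set
(`intervalSplitSum_eq`); its vanishing on all positions is the recursion.

For Brownian motion, Lagrange inversion of the S-transform gives the positive moments `Q_n(t)
e^{-nt/2}`; these are real, so negative powers have the same moments. Evaluation at `(t, e^{-t/2})`
is a ring homomorphism and commutes with the Möbius sum. Uniqueness is the algebraic independence of
`t` and `e^{-t/2}`. -/

open scoped NNReal

namespace FreeCumulants

/-! ### Non-crossing partitions of finite subsets of a linear order -/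

section NonCrossing

variable {α : Type*} [LinearOrder α]

/-- `P` is the set of blocks of a non-crossing partition of `S`. -/
structure IsNCPartition (S : Finset α) (P : Finset (Finset α)) : Prop where
  nonempty : ∀ V ∈ P, V.Nonempty
  subset : ∀ V ∈ P, V ⊆ S
  exists_mem : ∀ x ∈ S, ∃ V ∈ P, x ∈ V
  eq_of_mem : ∀ V ∈ P, ∀ W ∈ P, ∀ x, x ∈ V → x ∈ W → V = W
  nonCrossing : ∀ V ∈ P, ∀ W ∈ P, ∀ a b c d : α,
    a < b → b < c → c < d → a ∈ V → c ∈ V → b ∈ W → d ∈ W → V = W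

open Classical in
/-- The finite set of non-crossing partitions of `S`, as sets of blocks. -/
noncomputable def ncPartitions (S : Finset α) : Finset (Finset (Finset α)) :=
  S.powerset.powerset.filter (IsNCPartition S)

theorem mem_ncPartitions {S : Finset α} {P : Finset (Finset α)} :
    P ∈ ncPartitions S ↔ IsNCPartition S P := by
  classical
  simp only [ncPartitions, Finset.mem_filter, Finset.mem_powerset, and_iff_right_iff_imp]
  intro h V hV
  exact Finset.mem_powerset.2 (h.subset V hV)

theorem isNCPartition_singleton {S : Finset α} (hS : S.Nonempty) : IsNCPartition S {S} := by
  constructor <;> simp_all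

theorem IsNCPartition.eq_singleton {S : Finset α} {P : Finset (Finset α)}
    (h : IsNCPartition S P) (hS : S ∈ P) : P = {S} := by
  refine Finset.eq_singleton_iff_unique_mem.2 ⟨hS, fun V hV => ?_⟩
  obtain ⟨x, hx⟩ := h.nonempty V hV
  exact h.eq_of_mem V hV S hS x hx (h.subset V hV hx)

theorem ncPartitions_empty : ncPartitions (∅ : Finset α) = {∅} := by
  ext P
  rw [mem_ncPartitions, Finset.mem_singleton]
  constructor
  · intro h
    refine Finset.eq_empty_of_forall_notMem fun V hV => ?_
    obtain ⟨x, hx⟩ := h.nonempty V hV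
    exact absurd (h.subset V hV hx) (Finset.notMem_empty x)
  · rintro rfl
    constructor <;> simp

/-- Replace the block `V` of `P` by its two parts below and above `c`. -/
def splitBlock (P : Finset (Finset α)) (V : Finset α) (c : α) : Finset (Finset α) :=
  insert (V.filter (· < c)) (insert (V.filter (c ≤ ·)) (P.erase V))

/-- The two parts are separated by `c`, so they cannot cross each other, and a crossing with another
block would already be one with `V`. The points `a` and `c` keep both parts nonempty. -/
theorem IsNCPartition.splitBlock {S : Finset α} {P : Finset (Finset α)} (h : IsNCPartition S P)
    {V : Finset α} (hV : V ∈ P) {a c : α} (ha : a ∈ V) (hc : c ∈ V) (hac : a < c) :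
    IsNCPartition S (splitBlock P V c) := by
  obtain ⟨h1, h2, h3, h4, h5⟩ := h
  have hsub : ∀ W ∈ FreeCumulants.splitBlock P V c,
      (W = V.filter (· < c)) ∨ (W = V.filter (c ≤ ·)) ∨ (W ∈ P ∧ W ≠ V) := by
    intro W hW
    simp only [FreeCumulants.splitBlock, Finset.mem_insert, Finset.mem_erase] at hW
    tauto
  constructor
  · intro W hW
    rcases hsub W hW with rfl | rfl | hW
    · exact ⟨a, by simp [ha, hac]⟩
    · exact ⟨c, by simp [hc]⟩
    · exact h1 W hW.1
  · intro W hW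
    rcases hsub W hW with rfl | rfl | hW
    · exact (Finset.filter_subset _ _).trans (h2 V hV)
    · exact (Finset.filter_subset _ _).trans (h2 V hV)
    · exact h2 W hW.1
  · intro x hx
    obtain ⟨W, hW, hxW⟩ := h3 x hx
    by_cases hWV : W = V
    · subst hWV
      rcases lt_or_ge x c with hxc | hxc
      · exact ⟨_, Finset.mem_insert_self _ _, by simp [hxW, hxc]⟩
      · exact ⟨_, Finset.mem_insert_of_mem (Finset.mem_insert_self _ _), by simp [hxW, hxc]⟩
    · exact ⟨W, by simp [FreeCumulants.splitBlock, hW, hWV], hxW⟩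
  · intro W hW W' hW' x hx hx'
    rcases hsub W hW with rfl | rfl | hW <;> rcases hsub W' hW' with rfl | rfl | hW' <;>
      grind
  · intro W hW W' hW' p q r s hpq hqr hrs hp hr hq hs
    rcases hsub W hW with rfl | rfl | hW <;> rcases hsub W' hW' with rfl | rfl | hW'
    · rfl
    · simp only [Finset.mem_filter] at *
      exact absurd (hr.2.trans_le hq.2) hqr.asymm
    · simp only [Finset.mem_filter] at *
      exact absurd (h5 V hV W' hW'.1 p q r s hpq hqr hrs hp.1 hr.1 hq hs).symm hW'.2
    · simp only [Finset.mem_filter] at *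
      exact absurd (hs.2.trans_le hr.2) hrs.asymm
    · rfl
    · simp only [Finset.mem_filter] at *
      exact absurd (h5 V hV W' hW'.1 p q r s hpq hqr hrs hp.1 hr.1 hq hs).symm hW'.2
    · simp only [Finset.mem_filter] at *
      exact absurd (h5 W hW.1 V hV p q r s hpq hqr hrs hp hr hq.1 hs.1) hW.2
    · simp only [Finset.mem_filter] at *
      exact absurd (h5 W hW.1 V hV p q r s hpq hqr hrs hp hr hq.1 hs.1) hW.2
    · exact h5 W hW.1 W' hW'.1 p q r s hpq hqr hrs hp hr hq hs

/-- Replace two blocks `V`, `W` of `P` by their union. -/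
def mergeBlocks (P : Finset (Finset α)) (V W : Finset α) : Finset (Finset α) :=
  insert (V ∪ W) ((P.erase V).erase W)

/-- If `a` is the least and `b` the largest element of `S`, and they belong to different blocks
of a non-crossing partition, then the block of `a` lies below the block of `b`. -/
theorem IsNCPartition.lt_of_mem {S : Finset α} {P : Finset (Finset α)} (h : IsNCPartition S P)
    {a b : α} (hmin : ∀ x ∈ S, a ≤ x) (hmax : ∀ x ∈ S, x ≤ b)
    {V W : Finset α} (hV : V ∈ P) (hW : W ∈ P) (hVW : V ≠ W) (ha : a ∈ V) (hb : b ∈ W)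
    {x y : α} (hx : x ∈ V) (hy : y ∈ W) : x < y := by
  have hdis : ∀ z ∈ V, z ∉ W := fun z hz hz' => hVW (h.eq_of_mem V hV W hW z hz hz')
  by_contra! hyx
  have hyx : y < x := lt_of_le_of_ne hyx fun e => hdis x hx (e ▸ hy)
  have hay : a < y := lt_of_le_of_ne (hmin y (h.subset W hW hy)) fun e => hdis a ha (e ▸ hy)
  have hxb : x < b := lt_of_le_of_ne (hmax x (h.subset V hV hx)) fun e => hdis x hx (e ▸ hb)
  exact hVW (h.nonCrossing V hV W hW a y x b hay hyx hxb ha hx hy hb)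

/-- A crossing of the union with a third block `U` may use points of both `V` and `W`. Replacing an
outer point by the minimum `a` or the maximum `b` turns it into a crossing of `U` with `V` alone or
with `W` alone. -/
theorem IsNCPartition.mergeBlocks {S : Finset α} {P : Finset (Finset α)} (h : IsNCPartition S P)
    {a b : α} (hmin : ∀ x ∈ S, a ≤ x) (hmax : ∀ x ∈ S, x ≤ b)
    {V W : Finset α} (hV : V ∈ P) (hW : W ∈ P) (hVW : V ≠ W) (ha : a ∈ V) (hb : b ∈ W) :
    IsNCPartition S (mergeBlocks P V W) := by
  have hlt := fun x y => h.lt_of_mem hmin hmax hV hW hVW ha hb (x := x) (y := y)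
  obtain ⟨h1, h2, h3, h4, h5⟩ := h
  have hsub : ∀ U ∈ FreeCumulants.mergeBlocks P V W,
      (U = V ∪ W) ∨ (U ∈ P ∧ U ≠ V ∧ U ≠ W) := by
    intro U hU
    simp only [FreeCumulants.mergeBlocks, Finset.mem_insert, Finset.mem_erase] at hU
    tauto
  constructor
  · intro U hU
    rcases hsub U hU with rfl | hU
    · exact ⟨a, by simp [ha]⟩
    · exact h1 U hU.1
  · intro U hU
    rcases hsub U hU with rfl | hU
    · exact Finset.union_subset (h2 V hV) (h2 W hW)
    · exact h2 U hU.1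
  · intro x hx
    obtain ⟨U, hU, hxU⟩ := h3 x hx
    by_cases hUV : U = V
    · exact ⟨V ∪ W, by simp [FreeCumulants.mergeBlocks], by simp [← hUV, hxU]⟩
    by_cases hUW : U = W
    · exact ⟨V ∪ W, by simp [FreeCumulants.mergeBlocks], by simp [← hUW, hxU]⟩
    exact ⟨U, by simp [FreeCumulants.mergeBlocks, hU, hUV, hUW], hxU⟩
  · intro U hU U' hU' x hx hx'
    rcases hsub U hU with rfl | hU <;> rcases hsub U' hU' with rfl | hU' <;>
      grind
  · have key : ∀ U ∈ P, U ≠ V → U ≠ W → ∀ p q r s : α, p < q → q < r → r < s →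
        ((p ∈ V ∪ W ∧ r ∈ V ∪ W ∧ q ∈ U ∧ s ∈ U) ∨
          (p ∈ U ∧ r ∈ U ∧ q ∈ V ∪ W ∧ s ∈ V ∪ W)) → False := by
      intro U hU hUV hUW p q r s hpq hqr hrs hcase
      have cV := fun p q r s h1 h2 h3 e1 e2 e3 e4 =>
        hUV (h5 V hV U hU p q r s h1 h2 h3 e1 e2 e3 e4).symm
      have cW := fun p q r s h1 h2 h3 e1 e2 e3 e4 =>
        hUW (h5 W hW U hU p q r s h1 h2 h3 e1 e2 e3 e4).symm
      have cV' := fun p q r s h1 h2 h3 e1 e2 e3 e4 =>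
        hUV (h5 U hU V hV p q r s h1 h2 h3 e1 e2 e3 e4)
      have cW' := fun p q r s h1 h2 h3 e1 e2 e3 e4 =>
        hUW (h5 U hU W hW p q r s h1 h2 h3 e1 e2 e3 e4)
      have haU : a ∉ U := fun e => hUV (h4 U hU V hV a e ha)
      have hbU : b ∉ U := fun e => hUW (h4 U hU W hW b e hb)
      have hamin : ∀ x ∈ U, a < x := fun x hx =>
        lt_of_le_of_ne (hmin x (h2 U hU hx)) fun e => haU (e ▸ hx)
      have hbmax : ∀ x ∈ U, x < b := fun x hx =>
        lt_of_le_of_ne (hmax x (h2 U hU hx)) fun e => hbU (e ▸ hx)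
      simp only [Finset.mem_union] at hcase
      rcases hcase with ⟨hp, hr, hq, hs⟩ | ⟨hp, hr, hq, hs⟩
      · rcases hr with hr | hr
        · exact cV a q r s (hamin q hq) hqr hrs ha hr hq hs
        · exact cW' q r s b hqr hrs (hbmax s hs) hq hs hr hb
      · rcases hq with hq | hq
        · exact cV a p q r (hamin p hp) hpq hqr ha hq hp hr
        · exact cW' p q r b hpq hqr (hbmax r hr) hp hr hq hb
    intro U hU U' hU' p q r s hpq hqr hrs hp hr hq hs
    rcases hsub U hU with rfl | hU <;> rcases hsub U' hU' with rfl | hU'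
    · rfl
    · exact (key U' hU'.1 hU'.2.1 hU'.2.2 p q r s hpq hqr hrs (.inl ⟨hp, hr, hq, hs⟩)).elim
    · exact (key U hU.1 hU.2.1 hU.2.2 p q r s hpq hqr hrs (.inr ⟨hp, hr, hq, hs⟩)).elim
    · exact h5 U hU.1 U' hU'.1 p q r s hpq hqr hrs hp hr hq hs

/-! ### Regrouping partitions by the block containing both extreme points. -/

section Merge

variable {K : Type*} [CommRing K]

/-- The sum of `k V` and of all `k V₁ * k V₂` where `V = V₁ ∪ V₂` with `V₁` a proper lower
segment of `V` containing `a = min V`. -/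
def intervalSplitSum (k : Finset α → K) (a : α) (V : Finset α) : K :=
  k V + ∑ c ∈ V.erase a, k (V.filter (· < c)) * k (V.filter (c ≤ ·))

/-- Summation over non-crossing partitions of `S` after merging the blocks of `min S` and
`max S`. -/
theorem sum_ncPartitions_eq_sum_intervalSplitSum (k : Finset α → K) {S : Finset α} {a b : α}
    (ha : a ∈ S) (hb : b ∈ S) (hmin : ∀ x ∈ S, a ≤ x) (hmax : ∀ x ∈ S, x ≤ b) :
    ∑ P ∈ ncPartitions S, ∏ V ∈ P, k V =
      ∑ V ∈ S.powerset with a ∈ V ∧ b ∈ V, ∑ P ∈ ncPartitions S with V ∈ P,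
        intervalSplitSum k a V * ∏ W ∈ P.erase V, k W := by
  classical
  rw [← Finset.sum_filter_add_sum_filter_not (ncPartitions S)
    (fun P => ∃ V ∈ P, a ∈ V ∧ b ∈ V)]
  simp only [intervalSplitSum, add_mul, Finset.sum_add_distrib]
  congr 1
  -- Extremes in the same block: that block is the unique admissible `V`, and it contributes the
  -- term `k V`.
  · rw [Finset.sum_sigma']
    symm
    refine Finset.sum_nbij (fun x => x.2) ?_ ?_ ?_ ?_
    · rintro ⟨V, P⟩ h
      simp only [Finset.mem_sigma, Finset.mem_filter] at h ⊢
      exact ⟨h.2.1, V, h.2.2, h.1.2⟩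
    · rintro ⟨V, P⟩ h ⟨V', P'⟩ h' heq
      simp only [Finset.coe_sigma, Set.mem_sigma_iff, Finset.mem_coe, Finset.mem_filter] at h h'
      obtain rfl : P = P' := heq
      obtain rfl : V = V' := (mem_ncPartitions.1 h.2.1).eq_of_mem V h.2.2 V' h'.2.2 a
        h.1.2.1 h'.1.2.1
      rfl
    · intro P hP
      simp only [Finset.mem_coe, Finset.mem_filter] at hP
      obtain ⟨hP, V, hV, h⟩ := hP
      refine ⟨⟨V, P⟩, ?_, rfl⟩
      simp only [Finset.coe_sigma, Set.mem_sigma_iff, Finset.mem_coe, Finset.mem_filter,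
        Finset.mem_powerset]
      exact ⟨⟨(mem_ncPartitions.1 hP).subset V hV, h⟩, hP, hV⟩
    · rintro ⟨V, P⟩ h
      simp only [Finset.mem_sigma, Finset.mem_filter] at h ⊢
      exact Finset.mul_prod_erase P k h.2.2
  · simp only [Finset.sum_mul]
    rw [Finset.sum_sigma', Finset.sum_sigma']
    symm
    have hmem : ∀ x : (Σ _ : (Σ _ : Finset α, Finset (Finset α)), α),
        x ∈ (((S.powerset.filter fun V => a ∈ V ∧ b ∈ V).sigma fun V =>
          (ncPartitions S).filter fun P => V ∈ P).sigma fun x => x.1.erase a) →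
        (a ∈ x.1.1 ∧ b ∈ x.1.1) ∧ IsNCPartition S x.1.2 ∧ x.1.1 ∈ x.1.2 ∧ x.2 ∈ x.1.1 ∧
          a < x.2 := by
      rintro ⟨⟨V, P⟩, c⟩ h
      simp only [Finset.mem_sigma, Finset.mem_filter, Finset.mem_erase, Finset.mem_powerset,
        mem_ncPartitions] at h ⊢
      exact ⟨h.1.1.2, h.1.2.1, h.1.2.2, h.2.2, lt_of_le_of_ne (hmin _ (h.1.1.1 h.2.2))
        (Ne.symm h.2.1)⟩
    -- Extremes in different blocks: cutting `V` at `c` is a bijection onto these partitions. `V` is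
    -- recovered as the union of the blocks of `a` and `b`, and `c` as the least element of the
    -- block of `b`.
    refine Finset.sum_nbij (fun x => splitBlock x.1.2 x.1.1 x.2) ?_ ?_ ?_ ?_
    · intro x hx
      obtain ⟨⟨haV, hbV⟩, hP, hV, hc, hac⟩ := hmem x hx
      obtain ⟨⟨V, P⟩, c⟩ := x
      simp only [Finset.mem_filter, mem_ncPartitions]
      have hspl := hP.splitBlock hV haV hc hac
      refine ⟨hspl, ?_⟩
      rintro ⟨W, hW, haW, hbW⟩
      have : W = V.filter (· < c) := hspl.eq_of_mem W hW _ (Finset.mem_insert_self _ _) a haW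
        (by simp only [Finset.mem_filter]; exact ⟨haV, hac⟩)
      rw [this, Finset.mem_filter] at hbW
      exact absurd (hmax c (hP.subset V hV hc)) hbW.2.not_ge
    · intro x hx x' hx' heq
      obtain ⟨⟨haV, hbV⟩, hP, hV, hc, hac⟩ := hmem x hx
      obtain ⟨⟨haV', hbV'⟩, hP', hV', hc', hac'⟩ := hmem x' hx'
      obtain ⟨⟨V, P⟩, c⟩ := x
      obtain ⟨⟨V', P'⟩, c'⟩ := x'
      simp only at haV hbV hP hV hc hac haV' hbV' hP' hV' hc' hac' heq
      have hspl := hP.splitBlock hV haV hc hac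
      have hbc := hmax c (hP.subset V hV hc)
      have hbc' := hmax c' (hP'.subset V' hV' hc')
      have e1 : V.filter (· < c) = V'.filter (· < c') :=
        hspl.eq_of_mem _ (by simp [splitBlock]) _ (by rw [heq]; simp [splitBlock]) a
          (by simp [haV, hac]) (by simp [haV', hac'])
      have e2 : V.filter (c ≤ ·) = V'.filter (c' ≤ ·) :=
        hspl.eq_of_mem _ (by simp [splitBlock]) _ (by rw [heq]; simp [splitBlock]) b
          (by simp [hbV, hbc]) (by simp [hbV', hbc'])
      have eV : ∀ (V : Finset α) (c : α), V = V.filter (· < c) ∪ V.filter (c ≤ ·) := by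
        intro V c; ext x; simp only [Finset.mem_union, Finset.mem_filter]
        have := lt_or_ge x c
        tauto
      obtain rfl : V = V' := by rw [eV V c, eV V' c', e1, e2]
      obtain rfl : c = c' := by
        have m1 : c ∈ V.filter (c' ≤ ·) := by rw [← e2]; simp [hc]
        have m2 : c' ∈ V.filter (c ≤ ·) := by rw [e2]; simp [hc']
        simp only [Finset.mem_filter] at m1 m2
        exact le_antisymm m2.2 m1.2
      have eP : ∀ P : Finset (Finset α), IsNCPartition S P → V ∈ P →
          P = insert V (((splitBlock P V c).erase (V.filter (· < c))).erase
            (V.filter (c ≤ ·))) := by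
        intro P hP hV
        have n1 : V.filter (· < c) ∉ P.erase V := fun e => (Finset.mem_erase.1 e).1
          (hP.eq_of_mem _ (Finset.mem_erase.1 e).2 V hV a (by simp [haV, hac]) haV)
        have n2 : V.filter (c ≤ ·) ∉ P.erase V := fun e => (Finset.mem_erase.1 e).1
          (hP.eq_of_mem _ (Finset.mem_erase.1 e).2 V hV c (by simp [hc]) hc)
        have n3 : V.filter (· < c) ≠ V.filter (c ≤ ·) := by
          intro e
          have : c ∈ V.filter (· < c) := by rw [e]; simp [hc]
          simp at this
        rw [splitBlock, Finset.erase_insert (by simp [n3, n1]), Finset.erase_insert n2,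
          Finset.insert_erase hV]
      obtain rfl : P = P' := by rw [eP P hP hV, eP P' hP' hV', heq]
      rfl
    · intro P hP
      simp only [Finset.mem_coe, Finset.mem_filter, mem_ncPartitions] at hP
      obtain ⟨hP, hab⟩ := hP
      obtain ⟨V, hV, haV⟩ := hP.exists_mem a ha
      obtain ⟨W, hW, hbW⟩ := hP.exists_mem b hb
      have hVW : V ≠ W := fun e => hab ⟨V, hV, haV, e ▸ hbW⟩
      have hlt := fun x y => hP.lt_of_mem hmin hmax hV hW hVW haV hbW (x := x) (y := y)
      set c := W.min' ⟨b, hbW⟩ with hc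
      have hcW : c ∈ W := Finset.min'_mem _ _
      have hcle : ∀ y ∈ W, c ≤ y := fun y hy => Finset.min'_le _ _ hy
      have f1 : (V ∪ W).filter (· < c) = V := by
        ext x; simp only [Finset.mem_filter, Finset.mem_union]
        constructor
        · rintro ⟨h | h, h'⟩
          · exact h
          · exact absurd (hcle x h) h'.not_ge
        · exact fun h => ⟨.inl h, hlt x c h hcW⟩
      have f2 : (V ∪ W).filter (c ≤ ·) = W := by
        ext x; simp only [Finset.mem_filter, Finset.mem_union]
        constructor
        · rintro ⟨h | h, h'⟩
          · exact absurd (hlt x c h hcW) h'.not_gt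
          · exact h
        · exact fun h => ⟨.inr h, hcle x h⟩
      have hm := hP.mergeBlocks hmin hmax hV hW hVW haV hbW
      have hUm : V ∪ W ∈ mergeBlocks P V W := Finset.mem_insert_self _ _
      have hU : V ∪ W ∉ (P.erase V).erase W := by
        intro e
        simp only [Finset.mem_erase] at e
        exact e.2.1 (hP.eq_of_mem _ e.2.2 V hV a (by simp [haV]) haV)
      refine ⟨⟨⟨V ∪ W, mergeBlocks P V W⟩, c⟩, ?_, ?_⟩
      · simp only [Finset.coe_sigma, Set.mem_sigma_iff, Finset.mem_coe, Finset.mem_filter,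
          Finset.mem_powerset, mem_ncPartitions, Finset.mem_erase]
        refine ⟨⟨⟨hm.subset _ hUm, by simp [haV], by simp [hbW]⟩, hm, hUm⟩,
          (hlt a c haV hcW).ne', by simp [hcW]⟩
      · simp only [splitBlock, f1, f2, mergeBlocks, Finset.erase_insert hU]
        rw [Finset.insert_erase (Finset.mem_erase.2 ⟨hVW.symm, hW⟩), Finset.insert_erase hV]
    · intro x hx
      obtain ⟨⟨haV, hbV⟩, hP, hV, hc, hac⟩ := hmem x hx
      obtain ⟨⟨V, P⟩, c⟩ := x
      simp only at haV hbV hP hV hc hac ⊢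
      have n1 : V.filter (· < c) ∉ P.erase V := fun e => (Finset.mem_erase.1 e).1
        (hP.eq_of_mem _ (Finset.mem_erase.1 e).2 V hV a (by simp [haV, hac]) haV)
      have n2 : V.filter (c ≤ ·) ∉ P.erase V := fun e => (Finset.mem_erase.1 e).1
        (hP.eq_of_mem _ (Finset.mem_erase.1 e).2 V hV c (by simp [hc]) hc)
      have n3 : V.filter (· < c) ≠ V.filter (c ≤ ·) := by
        intro e
        have : c ∈ V.filter (· < c) := by rw [e]; simp [hc]
        simp at this
      rw [splitBlock, Finset.prod_insert (by simp [n3, n1]), Finset.prod_insert n2, mul_assoc]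

end Merge

end NonCrossing

/-! ### Vanishing of the split sums; refinements and transport of partitions. -/

section NonCrossing

variable {α : Type*} [LinearOrder α] {K : Type*} [CommRing K]

/-- A block consisting of the extreme points crosses nothing, so the remaining blocks are
unconstrained by it. -/
theorem sum_ncPartitions_pair_mem (k : Finset α → K) {S : Finset α} {a b : α}
    (ha : a ∈ S) (hb : b ∈ S) (hmin : ∀ x ∈ S, a ≤ x) (hmax : ∀ x ∈ S, x ≤ b) :
    ∑ P ∈ ncPartitions S with {a, b} ∈ P, ∏ W ∈ P.erase {a, b}, k W =
      ∑ P ∈ ncPartitions (S \ {a, b}), ∏ W ∈ P, k W := by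
  classical
  refine Finset.sum_nbij' (fun P => P.erase {a, b}) (fun P => insert {a, b} P) ?_ ?_ ?_ ?_ ?_
  · intro P hP
    simp only [Finset.mem_filter, mem_ncPartitions] at hP ⊢
    obtain ⟨⟨h1, h2, h3, h4, h5⟩, h⟩ := hP
    constructor
    · exact fun V hV => h1 V (Finset.mem_of_mem_erase hV)
    · intro V hV x hx
      have hV' := Finset.mem_erase.1 hV
      exact Finset.mem_sdiff.2 ⟨h2 V hV'.2 hx, fun hx' => hV'.1 (h4 V hV'.2 _ h x hx hx')⟩
    · intro x hx
      obtain ⟨hx, hx'⟩ := Finset.mem_sdiff.1 hx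
      obtain ⟨V, hV, hxV⟩ := h3 x hx
      exact ⟨V, Finset.mem_erase.2 ⟨fun e => hx' (e ▸ hxV), hV⟩, hxV⟩
    · exact fun V hV W hW =>
        h4 V (Finset.mem_of_mem_erase hV) W (Finset.mem_of_mem_erase hW)
    · exact fun V hV W hW =>
        h5 V (Finset.mem_of_mem_erase hV) W (Finset.mem_of_mem_erase hW)
  · intro P hP
    simp only [Finset.mem_filter, mem_ncPartitions] at hP ⊢
    obtain ⟨h1, h2, h3, h4, h5⟩ := hP
    have hdis : ∀ V ∈ P, ∀ x ∈ V, x ∈ S ∧ x ≠ a ∧ x ≠ b := by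
      intro V hV x hx
      simpa using h2 V hV hx
    refine ⟨?_, Finset.mem_insert_self _ _⟩
    constructor
    · simpa using h1
    · intro V hV
      rcases Finset.mem_insert.1 hV with rfl | hV
      · intro x hx
        rcases Finset.mem_insert.1 hx with rfl | hx
        · exact ha
        · rwa [Finset.mem_singleton.1 hx]
      · exact fun x hx => (hdis V hV x hx).1
    · intro x hx
      by_cases hx' : x ∈ ({a, b} : Finset α)
      · exact ⟨_, Finset.mem_insert_self _ _, hx'⟩
      · obtain ⟨V, hV, hxV⟩ := h3 x (Finset.mem_sdiff.2 ⟨hx, hx'⟩)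
        exact ⟨V, Finset.mem_insert_of_mem hV, hxV⟩
    · intro V hV W hW x hx hx'
      rcases Finset.mem_insert.1 hV with rfl | hV <;> rcases Finset.mem_insert.1 hW with rfl | hW
      · rfl
      · have := hdis W hW x hx'
        simp at hx
        tauto
      · have := hdis V hV x hx
        simp at hx'
        tauto
      · exact h4 V hV W hW x hx hx'
    · intro V hV W hW p q r s hpq hqr hrs hp hr hq hs
      rcases Finset.mem_insert.1 hV with rfl | hV <;> rcases Finset.mem_insert.1 hW with rfl | hW
      · rfl
      · have h6 := hmax s (hdis W hW s hs).1
        have h7 := hmin q (hdis W hW q hq).1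
        simp only [Finset.mem_insert, Finset.mem_singleton] at hp hr
        exfalso
        rcases hr with rfl | rfl
        · exact (hqr.trans_le h7).false
        · exact (hrs.trans_le h6).false
      · have h6 := hmax r (hdis V hV r hr).1
        have h7 := hmin p (hdis V hV p hp).1
        simp only [Finset.mem_insert, Finset.mem_singleton] at hq hs
        exfalso
        rcases hq with rfl | rfl
        · exact (hpq.trans_le h7).false
        · exact (hqr.trans_le h6).false
      · exact h5 V hV W hW p q r s hpq hqr hrs hp hr hq hs
  · intro P hP
    exact Finset.insert_erase (Finset.mem_filter.1 hP).2
  · intro P hP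
    refine Finset.erase_insert fun h => ?_
    have := (mem_ncPartitions.1 hP).subset _ h (Finset.mem_insert_self a _)
    simp at this
  · intro P hP
    rfl

theorem sum_ncPartitions_self_mem (k : Finset α → K) {S : Finset α} (hS : S.Nonempty) :
    ∑ P ∈ ncPartitions S with S ∈ P, ∏ W ∈ P.erase S, k W = 1 := by
  classical
  have : (ncPartitions S).filter (fun P => S ∈ P) = {{S}} := by
    ext P
    simp only [Finset.mem_filter, mem_ncPartitions, Finset.mem_singleton]
    constructor
    · exact fun h => h.1.eq_singleton h.2
    · rintro rfl
      exact ⟨isNCPartition_singleton hS, Finset.mem_singleton_self S⟩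
  rw [this, Finset.sum_singleton]
  simp

/-- If removing the least element `a` together with the largest element `b` does not change
moments, then the sums of cumulants `intervalSplitSum` vanish. -/
theorem intervalSplitSum_eq (k M : Finset α → K)
    (hM : ∀ S, M S = ∑ P ∈ ncPartitions S, ∏ V ∈ P, k V) {a b : α}
    (hab : ∀ S : Finset α, a ∈ S → b ∈ S → M S = M (S \ {a, b})) :
    ∀ S : Finset α, a ∈ S → b ∈ S → (∀ x ∈ S, a ≤ x) → (∀ x ∈ S, x ≤ b) →
      intervalSplitSum k a S = if S = {a, b} then 1 else 0 := by
  intro S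
  induction S using Finset.strongInduction with
  | H S ih =>
    intro ha hb hmin hmax
    have hM0 : M ∅ = 1 := by rw [hM, ncPartitions_empty]; simp
    have hpair : ({a, b} : Finset α) ⊆ S := by
      intro x hx
      rcases Finset.mem_insert.1 hx with rfl | hx
      · exact ha
      · rwa [Finset.mem_singleton.1 hx]
    set R : Finset α → K := fun V => ∑ P ∈ ncPartitions S with V ∈ P, ∏ W ∈ P.erase V, k W
      with hR
    have key : M S = ∑ V ∈ S.powerset with a ∈ V ∧ b ∈ V, intervalSplitSum k a V * R V := by
      rw [hM, sum_ncPartitions_eq_sum_intervalSplitSum k ha hb hmin hmax]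
      simp only [hR, Finset.mul_sum]
    have hRS : R S = 1 := sum_ncPartitions_self_mem k ⟨a, ha⟩
    have hRp : R {a, b} = M (S \ {a, b}) := by
      rw [hM]
      exact sum_ncPartitions_pair_mem k ha hb hmin hmax
    have hSmem : S ∈ S.powerset.filter (fun V => a ∈ V ∧ b ∈ V) := by simp [ha, hb]
    rw [← Finset.add_sum_erase _ _ hSmem, hRS, mul_one] at key
    have hrest : ∑ V ∈ (S.powerset.filter fun V => a ∈ V ∧ b ∈ V).erase S,
        intervalSplitSum k a V * R V =
        ∑ V ∈ (S.powerset.filter fun V => a ∈ V ∧ b ∈ V).erase S,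
          if V = {a, b} then R {a, b} else 0 := by
      refine Finset.sum_congr rfl fun V hV => ?_
      simp only [Finset.mem_erase, Finset.mem_filter, Finset.mem_powerset] at hV
      obtain ⟨hVS, hsub, haV, hbV⟩ := hV
      rw [ih V (lt_of_le_of_ne hsub hVS) haV hbV (fun x hx => hmin x (hsub hx))
        (fun x hx => hmax x (hsub hx))]
      split_ifs with h
      · rw [h, one_mul]
      · rw [zero_mul]
    -- By induction only `V = {a, b}` survives among the proper subsets, with coefficient `M (S \
    -- {a, b})`. It cancels the left side unless `S` is the pair itself, where `M ∅ = 1` remains.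
    rw [hrest, Finset.sum_ite_eq', hab S ha hb, hRp] at key
    by_cases hS : S = {a, b}
    · rw [if_neg (by simp [hS]), add_zero] at key
      rw [← key, if_pos hS, ← hM0]
      congr 1
      rw [Finset.sdiff_eq_empty_iff_subset, hS]
    · rw [if_pos (by simp [hpair, Ne.symm hS])] at key
      rw [if_neg hS]
      simpa using key

/-- A product over the blocks of `P` of sums over non-crossing partitions of the blocks is a sum
over the refinements of `P`. -/
theorem prod_sum_ncPartitions (k : Finset α → K) {S : Finset α} {P : Finset (Finset α)}
    (hP : IsNCPartition S P) :
    ∏ V ∈ P, ∑ Q ∈ ncPartitions V, ∏ W ∈ Q, k W =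
      ∑ R ∈ ncPartitions S with ∀ W ∈ R, ∃ V ∈ P, W ⊆ V, ∏ W ∈ R, k W := by
  classical
  rw [Finset.prod_sum]
  have hbi : ∀ p ∈ P.pi (fun V => ncPartitions V), ∀ V (hV : V ∈ P), IsNCPartition V (p V hV) :=
    fun p hp V hV => mem_ncPartitions.1 (Finset.mem_pi.1 hp V hV)
  have hmem : ∀ (p : ∀ V ∈ P, Finset (Finset α)) (W : Finset α),
      W ∈ P.attach.biUnion (fun V => p V.1 V.2) ↔ ∃ V, ∃ hV : V ∈ P, W ∈ p V hV := by
    intro p W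
    simp
  refine Finset.sum_bij' (fun p _ => P.attach.biUnion fun V => p V.1 V.2)
    (fun R _ V _ => R.filter (· ⊆ V)) ?_ ?_ ?_ ?_ ?_
  · intro p hp
    have hp' := hbi p hp
    simp only [Finset.mem_filter, mem_ncPartitions]
    refine ⟨⟨?_, ?_, ?_, ?_, ?_⟩, ?_⟩
    · intro W hW
      obtain ⟨V, hV, hWV⟩ := (hmem p W).1 hW
      exact (hp' V hV).nonempty W hWV
    · intro W hW
      obtain ⟨V, hV, hWV⟩ := (hmem p W).1 hW
      exact ((hp' V hV).subset W hWV).trans (hP.subset V hV)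
    · intro x hx
      obtain ⟨V, hV, hxV⟩ := hP.exists_mem x hx
      obtain ⟨W, hW, hxW⟩ := (hp' V hV).exists_mem x hxV
      exact ⟨W, (hmem p W).2 ⟨V, hV, hW⟩, hxW⟩
    · intro W hW W' hW' x hx hx'
      obtain ⟨V, hV, hWV⟩ := (hmem p W).1 hW
      obtain ⟨V', hV', hWV'⟩ := (hmem p W').1 hW'
      obtain rfl : V = V' := hP.eq_of_mem V hV V' hV' x ((hp' V hV).subset W hWV hx)
        ((hp' V' hV').subset W' hWV' hx')
      exact (hp' V hV).eq_of_mem W hWV W' hWV' x hx hx'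
    · intro W hW W' hW' a b c d hab hbc hcd ha hc hb hd
      obtain ⟨V, hV, hWV⟩ := (hmem p W).1 hW
      obtain ⟨V', hV', hWV'⟩ := (hmem p W').1 hW'
      have s := (hp' V hV).subset W hWV
      have s' := (hp' V' hV').subset W' hWV'
      obtain rfl : V = V' :=
        hP.nonCrossing V hV V' hV' a b c d hab hbc hcd (s ha) (s hc) (s' hb) (s' hd)
      exact (hp' V hV).nonCrossing W hWV W' hWV' a b c d hab hbc hcd ha hc hb hd
    · intro W hW
      obtain ⟨V, hV, hWV⟩ := (hmem p W).1 hW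
      exact ⟨V, hV, (hp' V hV).subset W hWV⟩
  · intro R hR
    simp only [Finset.mem_filter, mem_ncPartitions] at hR
    obtain ⟨hR, href⟩ := hR
    simp only [Finset.mem_pi, mem_ncPartitions]
    intro V hV
    have hsub : ∀ W ∈ R.filter (· ⊆ V), W ∈ R := fun W hW => (Finset.mem_filter.1 hW).1
    refine ⟨fun W hW => hR.nonempty W (hsub W hW), fun W hW => (Finset.mem_filter.1 hW).2, ?_,
      fun W hW W' hW' => hR.eq_of_mem W (hsub W hW) W' (hsub W' hW'),
      fun W hW W' hW' => hR.nonCrossing W (hsub W hW) W' (hsub W' hW')⟩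
    intro x hx
    obtain ⟨W, hW, hxW⟩ := hR.exists_mem x (hP.subset V hV hx)
    obtain ⟨V', hV', hWV'⟩ := href W hW
    obtain rfl : V = V' := hP.eq_of_mem V hV V' hV' x hx (hWV' hxW)
    exact ⟨W, Finset.mem_filter.2 ⟨hW, hWV'⟩, hxW⟩
  · intro p hp
    have hp' := hbi p hp
    funext V hV
    ext W
    simp only [Finset.mem_filter, hmem]
    constructor
    · rintro ⟨⟨V', hV', hWV'⟩, hWV⟩
      obtain ⟨x, hx⟩ := (hp' V' hV').nonempty W hWV'
      obtain rfl : V = V' := hP.eq_of_mem V hV V' hV' x (hWV hx)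
        ((hp' V' hV').subset W hWV' hx)
      exact hWV'
    · exact fun h => ⟨⟨V, hV, h⟩, (hp' V hV).subset W h⟩
  · intro R hR
    simp only [Finset.mem_filter, mem_ncPartitions] at hR
    ext W
    simp only [hmem (fun V _ => R.filter (· ⊆ V)), Finset.mem_filter]
    constructor
    · rintro ⟨V, hV, hW, -⟩
      exact hW
    · intro hW
      obtain ⟨V, hV, hWV⟩ := hR.2 W hW
      exact ⟨V, hV, hW, hWV⟩
  · intro p hp
    have hp' := hbi p hp
    rw [Finset.prod_biUnion]
    intro V _ V' _ hne
    rw [Function.onFun, Finset.disjoint_left]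
    intro W hW hW'
    obtain ⟨x, hx⟩ := (hp' V.1 V.2).nonempty W hW
    exact hne (Subtype.ext (hP.eq_of_mem V.1 V.2 V'.1 V'.2 x ((hp' V.1 V.2).subset W hW hx)
      ((hp' V'.1 V'.2).subset W hW' hx)))

theorem isNCPartition_map_iff {β : Type*} [LinearOrder β] (e : β ↪o α) {S : Finset β}
    {P : Finset (Finset β)} :
    IsNCPartition (S.map e.toEmbedding)
      (P.map (Finset.mapEmbedding e.toEmbedding).toEmbedding) ↔ IsNCPartition S P := by
  constructor
  · rintro ⟨h1, h2, h3, h4, h5⟩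
    simp only [Finset.mem_map, forall_exists_index, and_imp, forall_apply_eq_imp_iff₂,
      exists_exists_and_eq_and, RelEmbedding.coe_toEmbedding, Finset.mapEmbedding_apply,
      Finset.map_nonempty, Finset.map_subset_map, Finset.map_inj] at h1 h2 h3 h4 h5
    refine ⟨h1, h2, fun x hx => ?_, fun V hV W hW x hx hx' => ?_,
      fun V hV W hW a b c d hab hbc hcd ha hc hb hd => ?_⟩
    · obtain ⟨V, hV, y, hy, hyx⟩ := h3 x hx
      exact ⟨V, hV, e.injective hyx ▸ hy⟩
    · exact h4 V hV W hW x hx x hx' rfl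
    · exact h5 V hV W hW _ _ _ _ (e.lt_iff_lt.2 hab) (e.lt_iff_lt.2 hbc) (e.lt_iff_lt.2 hcd)
        a ha rfl c hc rfl b hb rfl d hd rfl
  · rintro ⟨h1, h2, h3, h4, h5⟩
    constructor
    · simpa using h1
    · simpa using h2
    · simpa using h3
    · simp only [Finset.mem_map, forall_exists_index, and_imp, forall_apply_eq_imp_iff₂,
        RelEmbedding.coe_toEmbedding, Finset.mapEmbedding_apply, Finset.map_inj]
      intro V hV W hW x hx y hy hxy
      exact h4 V hV W hW x hx (e.injective hxy ▸ hy)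
    · simp only [Finset.mem_map, forall_exists_index, and_imp, forall_apply_eq_imp_iff₂,
        RelEmbedding.coe_toEmbedding, Finset.mapEmbedding_apply, Finset.map_inj]
      rintro V hV W hW _ _ _ _ hab hbc hcd a ha rfl c hc rfl b hb rfl d hd rfl
      exact h5 V hV W hW a b c d (e.lt_iff_lt.1 hab) (e.lt_iff_lt.1 hbc) (e.lt_iff_lt.1 hcd)
        ha hc hb hd

/-- Being non-crossing depends only on the order. This passes between the positions of a restricted
tuple and those of the original tuple. -/
theorem sum_ncPartitions_map {β : Type*} [LinearOrder β] (e : β ↪o α) (S : Finset β)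
    (k : Finset α → K) :
    ∑ P ∈ ncPartitions (S.map e.toEmbedding), ∏ V ∈ P, k V =
      ∑ P ∈ ncPartitions S, ∏ V ∈ P, k (V.map e.toEmbedding) := by
  symm
  refine Finset.sum_nbij (fun P => P.map (Finset.mapEmbedding e.toEmbedding).toEmbedding)
    ?_ ?_ ?_ ?_
  · intro P hP
    rw [mem_ncPartitions] at hP ⊢
    exact (isNCPartition_map_iff e).2 hP
  · exact (Finset.map_injective _).injOn
  · intro Q hQ
    have hQ' := mem_ncPartitions.1 hQ
    obtain ⟨P, -, rfl⟩ : ∃ P, P ⊆ S.powerset ∧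
        Q = P.map (Finset.mapEmbedding e.toEmbedding).toEmbedding := by
      refine Finset.subset_map_iff.1 fun V hV => ?_
      obtain ⟨V', hV', rfl⟩ := Finset.subset_map_iff.1 (hQ'.subset V hV)
      exact Finset.mem_map.2 ⟨V', Finset.mem_powerset.2 hV', rfl⟩
    exact ⟨P, mem_ncPartitions.2 ((isNCPartition_map_iff e).1 hQ'), rfl⟩
  · intro P hP
    simp

end NonCrossing

/-! ### Möbius inversion in the lattice of non-crossing partitions. -/

section Moebius

variable {K : Type*} [CommRing K]

theorem isNCPartition_parts {n : ℕ} (π : NC n) :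
    IsNCPartition (Finset.univ : Finset (Fin n)) π.1.parts :=
  ⟨fun _ hV => π.1.nonempty_of_mem_parts hV, fun V _ => Finset.subset_univ V,
    fun _ hx => π.1.exists_mem hx, fun _ hV _ hW _ hx hx' => π.1.eq_of_mem_parts hV hW hx hx',
    π.2⟩

theorem IsNCPartition.exists_parts_eq {n : ℕ} {P : Finset (Finset (Fin n))}
    (h : IsNCPartition Finset.univ P) : ∃ π : NC n, π.1.parts = P := by
  refine ⟨⟨⟨P, ?_, ?_, ?_⟩, h.nonCrossing⟩, rfl⟩
  · rw [Finset.supIndep_iff_pairwiseDisjoint]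
    intro V hV W hW hne
    rw [Function.onFun, id, id, Finset.disjoint_left]
    exact fun x hx hx' => hne (h.eq_of_mem V hV W hW x hx hx')
  · refine Finset.eq_univ_iff_forall.2 fun x => ?_
    obtain ⟨V, hV, hx⟩ := h.exists_mem x (Finset.mem_univ x)
    exact Finset.mem_sup.2 ⟨V, hV, hx⟩
  · intro h0
    exact Finset.not_nonempty_empty (h.nonempty _ h0)

theorem nc_ext {n : ℕ} {π ρ : NC n} (h : π.1.parts = ρ.1.parts) : π = ρ :=
  Subtype.ext (Finpartition.ext h)

theorem sum_nc_eq_sum_ncPartitions {n : ℕ} (p : Finset (Finset (Fin n)) → Prop)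
    [DecidablePred p] (f : Finset (Finset (Fin n)) → K) :
    ∑ π : NC n with p π.1.parts, f π.1.parts =
      ∑ P ∈ ncPartitions (Finset.univ : Finset (Fin n)) with p P, f P := by
  refine Finset.sum_nbij (fun π => π.1.parts) ?_ ?_ ?_ ?_
  · intro π hπ
    exact Finset.mem_filter.2 ⟨mem_ncPartitions.2 (isNCPartition_parts π),
      (Finset.mem_filter.1 hπ).2⟩
  · exact fun π _ ρ _ h => nc_ext h
  · intro P hP
    obtain ⟨hP, hp⟩ := Finset.mem_filter.1 hP
    obtain ⟨π, rfl⟩ := (mem_ncPartitions.1 hP).exists_parts_eq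
    exact ⟨π, by simpa using hp, rfl⟩
  · exact fun _ _ => rfl

open Classical in
theorem sum_moebTop_mul {n : ℕ} (f g : NC n → K)
    (h : ∀ π, f π = ∑ σ : NC n with σ ≤ π, g σ) :
    ∑ π : NC n, (moebTop π : K) * f π = g ⊤ := by
  classical
  simp only [h, Finset.mul_sum, Finset.sum_filter, mul_ite, mul_zero]
  rw [Finset.sum_comm]
  have : ∀ σ : NC n, (∑ π : NC n, if σ ≤ π then (moebTop π : K) * g σ else 0) =
      if σ = ⊤ then g ⊤ else 0 := by
    intro σ
    have h1 := IncidenceAlgebra.sum_Icc_mu_left (𝕜 := ℤ) σ (⊤ : NC n)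
    rw [← Finset.sum_filter, ← Finset.sum_mul]
    have h2 : Finset.univ.filter (fun π : NC n => σ ≤ π) = Finset.Icc σ ⊤ := by
      ext π; simp
    have h3 := congrArg (Int.cast : ℤ → K) h1
    push_cast at h3
    rw [h2]
    simp only [moebTop]
    rw [h3]
    split_ifs with h4
    · rw [h4, one_mul]
    · rw [zero_mul]
  rw [Finset.sum_congr rfl fun σ _ => this σ]
  simp

theorem le_iff_forall_parts {n : ℕ} (σ π : NC n) :
    σ ≤ π ↔ ∀ W ∈ σ.1.parts, ∃ V ∈ π.1.parts, W ⊆ V := Iff.rfl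

theorem univ_mem_parts_iff {n : ℕ} (hn : n ≠ 0) (π : NC n) :
    Finset.univ ∈ π.1.parts ↔ π = ⊤ := by
  have : Nonempty (Fin n) := ⟨⟨0, Nat.pos_of_ne_zero hn⟩⟩
  constructor
  · intro h
    refine le_antisymm le_top fun W hW => ⟨Finset.univ, h, Finset.subset_univ W⟩
  · rintro rfl
    obtain ⟨ρ, hρ⟩ := (isNCPartition_singleton (Finset.univ_nonempty (α := Fin n))).exists_parts_eq
    have h1 : ρ ≤ ⊤ := le_top
    obtain ⟨V, hV, hV'⟩ := h1 (b := Finset.univ) (by rw [hρ]; exact Finset.mem_singleton_self _)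
    rwa [Finset.univ_subset_iff.1 hV'] at hV

end Moebius

/-! ### Restrictions of tuples and order embeddings of positions. -/

section Restrict

variable {X : Type*}

theorem length_restrict (x : List X) (V : Finset (Fin x.length)) :
    (restrict x V).length = V.card := by
  simp [restrict]

theorem sort_map_orderEmbedding {α β : Type*} [LinearOrder α] [LinearOrder β] (e : α ↪o β)
    (S : Finset α) : (S.map e.toEmbedding).sort (· ≤ ·) = (S.sort (· ≤ ·)).map e :=
  (Finset.map_sort (r := (· ≤ ·)) (r' := (· ≤ ·)) e.toEmbedding S
    fun _ _ _ _ => e.le_iff_le.symm).symm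

theorem restrict_map_of_get {x y : List X} (e : Fin y.length ↪o Fin x.length)
    (h : ∀ i, y.get i = x.get (e i)) (V : Finset (Fin y.length)) :
    restrict y V = restrict x (V.map e.toEmbedding) := by
  rw [restrict, restrict, sort_map_orderEmbedding, List.map_map]
  exact List.map_congr_left fun i _ => h i

theorem exists_orderEmbedding_restrict (x : List X) (S : Finset (Fin x.length)) :
    ∃ e : Fin (restrict x S).length ↪o Fin x.length, Finset.univ.map e.toEmbedding = S ∧
      ∀ i, (restrict x S).get i = x.get (e i) := by
  refine ⟨S.orderEmbOfFin (length_restrict x S).symm, Finset.map_orderEmbOfFin_univ _ _, ?_⟩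
  intro i
  rw [Finset.orderEmbOfFin_apply]
  exact List.getElem_map _

theorem restrict_univ (x : List X) : restrict x Finset.univ = x := by
  rw [restrict, Fin.sort_univ]
  exact List.map_get_finRange x

end Restrict

/-! ### The moment-cumulant formula. -/

section MomentCumulant

variable {X K : Type*} [CommRing K]

theorem sum_ncPartitions_restrict (c : List X → K) (x : List X) (S : Finset (Fin x.length)) :
    ∑ P ∈ ncPartitions (Finset.univ : Finset (Fin (restrict x S).length)),
        ∏ V ∈ P, c (restrict (restrict x S) V) =
      ∑ P ∈ ncPartitions S, ∏ V ∈ P, c (restrict x V) := by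
  obtain ⟨e, he, hget⟩ := exists_orderEmbedding_restrict x S
  have h := sum_ncPartitions_map e Finset.univ fun V => c (restrict x V)
  rw [he] at h
  rw [h]
  simp only [restrict_map_of_get e hget]

/-- The moment-cumulant formula. -/
theorem moment_eq_sum_moebiusSum (M : List X → K) (hM : M [] = 1) (x : List X) :
    M x = ∑ P ∈ ncPartitions (Finset.univ : Finset (Fin x.length)),
      ∏ V ∈ P, moebiusSum M (restrict x V) := by
  classical
  suffices H : ∀ n (x : List X), x.length = n →
      M x = ∑ P ∈ ncPartitions (Finset.univ : Finset (Fin x.length)),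
        ∏ V ∈ P, moebiusSum M (restrict x V) from H _ x rfl
  clear x
  intro n
  induction n using Nat.strong_induction_on with
  | _ n ih =>
  rintro x rfl
  by_cases h0 : x.length = 0
  · obtain rfl := List.length_eq_zero_iff.1 h0
    have : (Finset.univ : Finset (Fin ([] : List X).length)) = ∅ := rfl
    rw [this, ncPartitions_empty, hM]
    simp
  set F : NC x.length → K := fun σ => ∏ V ∈ σ.1.parts, moebiusSum M (restrict x V) with hF
  -- The value at `⊤` is chosen so that the sum of `g` over all partitions is `M x`. Below `⊤` the
  -- blocks are shorter than `x`, so induction supplies the sum formula there, and Möbius inversion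
  -- identifies `g ⊤` with `moebiusSum M x`.
  set g : NC x.length → K := fun σ =>
    if σ = ⊤ then M x - ∑ σ : NC x.length with σ ≠ ⊤, F σ else F σ with hg
  have htop : (⊤ : NC x.length).1.parts = {Finset.univ} :=
    (isNCPartition_parts _).eq_singleton ((univ_mem_parts_iff h0 _).2 rfl)
  have hinv : ∀ π : NC x.length, ∏ V ∈ π.1.parts, M (restrict x V) =
      ∑ σ : NC x.length with σ ≤ π, g σ := by
    intro π
    by_cases hπ : π = ⊤
    · subst hπ
      rw [htop, Finset.prod_singleton, restrict_univ, Finset.filter_true_of_mem fun _ _ => le_top,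
        ← Finset.sum_filter_add_sum_filter_not Finset.univ (fun σ : NC x.length => σ = ⊤)]
      have e1 : Finset.univ.filter (fun σ : NC x.length => σ = ⊤) = {⊤} := by ext; simp
      have e2 : ∑ σ : NC x.length with ¬ σ = ⊤, g σ = ∑ σ : NC x.length with σ ≠ ⊤, F σ :=
        Finset.sum_congr rfl fun σ hσ => if_neg (Finset.mem_filter.1 hσ).2
      rw [e1, e2, Finset.sum_singleton, hg]
      simp
    · have hV : ∀ V ∈ π.1.parts, M (restrict x V) =
          ∑ Q ∈ ncPartitions V, ∏ W ∈ Q, moebiusSum M (restrict x W) := by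
        intro V hV
        rw [← sum_ncPartitions_restrict]
        refine ih _ ?_ _ rfl
        rw [length_restrict]
        have hne : V ≠ Finset.univ := fun e => hπ ((univ_mem_parts_iff h0 π).1 (e ▸ hV))
        simpa using Finset.card_lt_card (Finset.ssubset_univ_iff.2 hne)
      rw [Finset.prod_congr rfl hV, prod_sum_ncPartitions _ (isNCPartition_parts π),
        ← sum_nc_eq_sum_ncPartitions]
      refine Finset.sum_congr ?_ fun σ hσ => ?_
      · ext σ
        simp only [Finset.mem_filter, le_iff_forall_parts]
      · have hσ' : σ ≤ π := (Finset.mem_filter.1 hσ).2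
        have : σ ≠ ⊤ := fun e => hπ (top_le_iff.1 (e ▸ hσ'))
        rw [hg]
        simp only [if_neg this, hF]
  have hc : moebiusSum M x = M x - ∑ σ : NC x.length with σ ≠ ⊤, F σ := by
    have := sum_moebTop_mul _ g hinv
    rw [moebiusSum, this, hg]
    simp
  have hsum := sum_nc_eq_sum_ncPartitions (n := x.length) (fun _ => True)
    fun P => ∏ V ∈ P, moebiusSum M (restrict x V)
  simp only [Finset.filter_true] at hsum
  rw [← hsum, ← Finset.sum_filter_add_sum_filter_not Finset.univ (fun σ : NC x.length => σ = ⊤)]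
  have e1 : Finset.univ.filter (fun σ : NC x.length => σ = ⊤) = {⊤} := by ext; simp
  rw [e1, Finset.sum_singleton, htop, Finset.prod_singleton, restrict_univ, hc, sub_add_cancel]

theorem moment_restrict_eq_sum (M : List X → K) (hM : M [] = 1) (x : List X)
    (S : Finset (Fin x.length)) :
    M (restrict x S) = ∑ P ∈ ncPartitions S, ∏ V ∈ P, moebiusSum M (restrict x V) := by
  rw [moment_eq_sum_moebiusSum M hM, sum_ncPartitions_restrict]

end MomentCumulant

/-! ### Compatibility of Möbius sums with maps of letters and of coefficients. -/

section Functoriality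

variable {X Y K L : Type*} [CommRing K] [CommRing L]

theorem moebiusSum_map (M : List Y → K) (f : X → Y) (x : List X) :
    moebiusSum M (x.map f) = moebiusSum (fun l => M (l.map f)) x := by
  -- The lengths of `x.map f` and `x` agree only propositionally; a free `n` lets the index type `NC
  -- n` be substituted.
  have key : ∀ (n : ℕ) (h : x.length = n) (s : Fin n → Y), (∀ i, s i = f (x.get (i.cast h.symm))) →
      ∑ π : NC n, (moebTop π : K) * ∏ V ∈ π.1.parts, M ((V.sort (· ≤ ·)).map s) =
        moebiusSum (fun l => M (l.map f)) x := by
    rintro n rfl s hs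
    obtain rfl : s = fun i => f (x.get i) := funext hs
    simp only [moebiusSum, restrict, List.map_map]
    rfl
  exact key _ (by simp) _ (by simp)

theorem map_moebiusSum (φ : K →+* L) (M : List X → K) (x : List X) :
    φ (moebiusSum M x) = moebiusSum (fun l => φ (M l)) x := by
  simp [moebiusSum]

end Functoriality

/-! ### The quadratic recursion for weight-dependent moments. -/

section Recursion

variable {X K : Type*} [CommRing K]

theorem eq_restrict_of_get {x y : List X} (e : Fin y.length ↪o Fin x.length)
    (h : ∀ i, y.get i = x.get (e i)) : y = restrict x (Finset.univ.map e.toEmbedding) := by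
  rw [← restrict_map_of_get e h, restrict_univ]

theorem restrict_filter_lt (x : List X) (c : Fin x.length) :
    restrict x (Finset.univ.filter (· < c)) = x.take c := by
  have hlen : (x.take c).length = c := by simp [c.2.le]
  rw [eq_restrict_of_get (x := x) (y := x.take c)
    (Fin.castLEOrderEmb (by rw [hlen]; exact c.2.le)) (by intro i; simp)]
  congr 1
  ext i
  simp only [Finset.mem_filter, Finset.mem_univ, true_and, Finset.mem_map,
    RelEmbedding.coe_toEmbedding]
  constructor
  · intro h
    exact ⟨⟨i, by rw [hlen]; exact h⟩, rfl⟩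
  · rintro ⟨j, rfl⟩
    have := j.2
    rw [Fin.lt_def]
    simpa [hlen] using this

theorem restrict_filter_ge (x : List X) (c : Fin x.length) :
    restrict x (Finset.univ.filter (c ≤ ·)) = x.drop c := by
  have hlen : (x.drop c).length = x.length - c := by simp
  have hlt : ∀ i : Fin (x.drop c).length, c + (i : ℕ) < x.length := by
    intro i
    have := i.2
    omega
  have hmono : StrictMono fun i : Fin (x.drop c).length => (⟨c + i, hlt i⟩ : Fin x.length) :=
    fun i j hij => Fin.lt_def.2 (Nat.add_lt_add_left (Fin.lt_def.1 hij) _)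
  obtain ⟨e, he⟩ : ∃ e : Fin (x.drop c).length ↪o Fin x.length, ∀ i, e i = ⟨c + i, hlt i⟩ :=
    ⟨OrderEmbedding.ofStrictMono _ hmono, fun _ => rfl⟩
  rw [eq_restrict_of_get (x := x) (y := x.drop c) e (by intro i; rw [he]; simp)]
  congr 1
  ext i
  simp only [Finset.mem_filter, Finset.mem_univ, true_and, Finset.mem_map,
    RelEmbedding.coe_toEmbedding, he]
  constructor
  · intro h
    have h' : (c : ℕ) ≤ i := h
    exact ⟨⟨i - c, by omega⟩, Fin.ext (Nat.add_sub_cancel' h')⟩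
  · rintro ⟨j, rfl⟩
    exact Fin.le_def.2 (Nat.le_add_right _ _)

/-- The exponent `1` or `-1` of a unitary represented by a symbol. -/
def Symb.weight : Symb → ℤ
  | .one => 1
  | .star => -1

theorem sum_map_restrict (f : X → ℤ) (x : List X) (S : Finset (Fin x.length)) :
    ((restrict x S).map f).sum = ∑ i ∈ S, f (x.get i) := by
  rw [restrict, List.map_map, ← Multiset.sum_coe, ← Multiset.map_coe, Finset.sort_eq]
  rfl

/-- The quadratic recursion for the cumulants associated with moments which depend only on the
total weight of a string. -/
theorem moebiusSum_weight_recursion (m : ℤ → K) (h0 : m 0 = 1) (n : ℕ) (hn : 3 ≤ n)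
    (ω : List Symb) (hlen : ω.length = n) (hhead : ω.head? = some Symb.one)
    (hlast : ω.getLast? = some Symb.star) :
    moebiusSum (fun l => m (l.map Symb.weight).sum) ω =
      -∑ j ∈ Finset.Icc 1 (n - 1), moebiusSum (fun l => m (l.map Symb.weight).sum) (ω.take j) *
        moebiusSum (fun l => m (l.map Symb.weight).sum) (ω.drop j) := by
  subst hlen
  set M : List Symb → K := fun l => m (l.map Symb.weight).sum with hM
  let a : Fin ω.length := ⟨0, by omega⟩
  let b : Fin ω.length := ⟨ω.length - 1, by omega⟩
  have hne : a ≠ b := fun e => by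
    have := congrArg Fin.val e
    simp only [a, b] at this
    omega
  have ha : ω.get a = Symb.one := by
    rw [List.head?_eq_getElem?, List.getElem?_eq_getElem (by omega)] at hhead
    exact Option.some_injective _ hhead
  have hb : ω.get b = Symb.star := by
    rw [List.getLast?_eq_getElem?, List.getElem?_eq_getElem (by omega)] at hlast
    exact Option.some_injective _ hlast
  have hab : ∀ S : Finset (Fin ω.length), a ∈ S → b ∈ S →
      M (restrict ω S) = M (restrict ω (S \ {a, b})) := by
    intro S haS hbS
    have hsub : {a, b} ⊆ S := by
      intro x hx
      rcases Finset.mem_insert.1 hx with rfl | hx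
      · exact haS
      · rwa [Finset.mem_singleton.1 hx]
    simp only [hM, sum_map_restrict]
    rw [← Finset.sum_sdiff hsub, Finset.sum_pair hne, ha, hb]
    simp [Symb.weight]
  have key := intervalSplitSum_eq (fun V => moebiusSum M (restrict ω V))
    (fun V => M (restrict ω V)) (moment_restrict_eq_sum M (by simp [hM, h0]) ω) hab Finset.univ
    (Finset.mem_univ a) (Finset.mem_univ b) (fun x _ => Fin.mk_le_of_le_val (Nat.zero_le _))
    (fun x _ => Fin.le_def.2 (Nat.le_sub_one_of_lt x.2))
  -- The case distinction takes the value 0 because at least three positions exceed the pair `{a,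
  -- b}`. Cuts at `c ≠ a` are exactly the prefixes of length `1, …, n - 1`.
  rw [if_neg, intervalSplitSum, restrict_univ] at key
  · rw [eq_neg_iff_add_eq_zero, ← key]
    congr 1
    symm
    refine Finset.sum_nbij Fin.val ?_ Fin.val_injective.injOn ?_ ?_
    · intro c hc
      have hc' : c ≠ a := (Finset.mem_erase.1 hc).1
      have : (c : ℕ) ≠ 0 := fun e => hc' (Fin.ext e)
      have := c.2
      rw [Finset.mem_Icc]
      omega
    · intro j hj
      have hj' := Finset.mem_Icc.1 (Finset.mem_coe.1 hj)
      refine ⟨⟨j, by omega⟩, ?_, rfl⟩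
      simp only [Finset.coe_erase, Finset.coe_univ, Set.mem_sdiff, Set.mem_univ, true_and,
        Set.mem_singleton_iff]
      intro e
      have := congrArg Fin.val e
      simp only [a] at this
      omega
    · intro c _
      rw [restrict_filter_lt, restrict_filter_ge]
  · intro e
    have h1 := congrArg Finset.card e
    have h2 := Finset.card_le_two (a := a) (b := b)
    simp only [Finset.card_univ, Fintype.card_fin] at h1
    omega

end Recursion

/-! ### Words in a unitary, and the polynomial moments. -/

section Words

theorem sum_map_weight (ω : List Symb) :
    (ω.map Symb.weight).sum = (ω.count Symb.one : ℤ) - (ω.count Symb.star : ℤ) := by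
  induction ω with
  | nil => simp
  | cons s ω ih =>
    cases s <;> simp [ih, Symb.weight] <;> ring

/-- The polynomials giving the moments of the powers of a free unitary Brownian motion. -/
noncomputable def polyMoment (j : ℤ) : MvPolynomial (Fin 2) ℚ :=
  if j = 0 then 1 else polyQ j.natAbs * MvPolynomial.X 1 ^ j.natAbs

theorem polyM_eq (ω : List Symb) : polyM ω = polyMoment (ω.map Symb.weight).sum := by
  rw [polyM, polyMoment, sum_map_weight]
  simp only [sub_eq_zero, Nat.cast_inj]

variable {A : Type*} [Ring A] [StarRing A]

/-- The adjoint of a unitary is its inverse, so every word collapses to an integer power. -/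
theorem prod_stringPow (u : unitary A) (ω : List Symb) :
    (stringPow (u : A) ω).prod = ((u ^ (ω.map Symb.weight).sum : unitary A) : A) := by
  induction ω with
  | nil => simp [stringPow]
  | cons s ω ih =>
    rw [stringPow, List.map_cons, List.prod_cons, List.map_cons, List.sum_cons, zpow_add,
      Submonoid.coe_mul, ← ih, stringPow]
    cases s
    · simp [symbPow, Symb.weight]
    · simp only [symbPow, Symb.weight, zpow_neg, zpow_one]
      rfl

variable [Algebra ℂ A]

theorem freeCumulant_stringPow (φ : A →ₗ[ℂ] ℂ) (u : unitary A) (ω : List Symb) :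
    freeCumulant φ (stringPow (u : A) ω) =
      moebiusSum (fun l => φ ((u ^ (l.map Symb.weight).sum : unitary A) : A)) ω := by
  rw [freeCumulant, stringPow, moebiusSum_map]
  congr 1
  funext l
  rw [← prod_stringPow]
  rfl

theorem freeCumulant_recursion (φ : A →ₗ[ℂ] ℂ) (hφ : φ 1 = 1) (u : A) (hu : u ∈ unitary A)
    (n : ℕ) (hn : 3 ≤ n) (ω : List Symb) (hlen : ω.length = n)
    (hhead : ω.head? = some Symb.one) (hlast : ω.getLast? = some Symb.star) :
    freeCumulant φ (stringPow u ω) =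
      -∑ m ∈ Finset.Icc 1 (n - 1),
        freeCumulant φ (stringPow u (ω.take m)) * freeCumulant φ (stringPow u (ω.drop m)) := by
  lift u to unitary A using hu
  simp only [freeCumulant_stringPow]
  exact moebiusSum_weight_recursion (fun j => φ ((u ^ j : unitary A) : A)) (by simp [hφ]) n hn ω
    hlen hhead hlast

theorem polyZ_eq (ω : List Symb) :
    polyZ ω = moebiusSum (fun l => polyMoment (l.map Symb.weight).sum) ω := by
  rw [polyZ]
  congr 1
  exact funext polyM_eq

theorem polyZ_recursion (n : ℕ) (hn : 3 ≤ n) (ω : List Symb) (hlen : ω.length = n)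
    (hhead : ω.head? = some Symb.one) (hlast : ω.getLast? = some Symb.star) :
    polyZ ω = -∑ m ∈ Finset.Icc 1 (n - 1), polyZ (ω.take m) * polyZ (ω.drop m) := by
  simp only [polyZ_eq]
  exact moebiusSum_weight_recursion polyMoment (by simp [polyMoment]) n hn ω hlen hhead hlast

end Words

/-! ### Lagrange inversion for formal power series. -/

section Lagrange

open PowerSeries

/-- With `h = X / χ` this coefficient is the residue of `χ' / χ^(N+1)`, which is an exact derivative
for `N > 0` and a logarithmic derivative for `N = 0`. Differentiating `χ * h = X` gives a proof
without Laurent series. -/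
theorem coeff_derivative_mul_pow {χ h : PowerSeries ℂ} (h0 : constantCoeff χ = 0)
    (hχ : χ * h = X) (N : ℕ) : coeff N (d⁄dX ℂ χ * h ^ (N + 1)) = if N = 0 then 1 else 0 := by
  have hd : d⁄dX ℂ χ * h = 1 - χ * d⁄dX ℂ h := by
    have := congrArg (d⁄dX ℂ) hχ
    rw [Derivation.leibniz, derivative_X, smul_eq_mul, smul_eq_mul] at this
    linear_combination this
  rcases N with _ | N
  · rw [zero_add, pow_one, hd, coeff_zero_eq_constantCoeff]
    simp [h0]
  · rw [if_neg (Nat.succ_ne_zero N)]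
    have e1 : d⁄dX ℂ χ * h ^ (N + 1 + 1) = h ^ (N + 1) - X * (h ^ N * d⁄dX ℂ h) := by
      rw [← hχ]
      linear_combination h ^ (N + 1) * hd
    have e2 : ((N : ℂ) + 1) * coeff N (h ^ N * d⁄dX ℂ h) =
        ((N : ℂ) + 1) * coeff (N + 1) (h ^ (N + 1)) := by
      have := coeff_derivative (h ^ (N + 1)) N
      rw [Derivation.leibniz_pow] at this
      simp only [Nat.add_sub_cancel, nsmul_eq_mul, smul_eq_mul] at this
      rw [mul_comm, mul_comm _ (coeff (N + 1) _), ← this, mul_comm]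
      have e3 : ((N + 1 : ℕ) : PowerSeries ℂ) = C ((N : ℂ) + 1) := by simp
      rw [e3, coeff_C_mul]
    rw [e1, map_sub, coeff_succ_X_mul, sub_eq_zero]
    exact (mul_left_cancel₀ (Nat.cast_add_one_ne_zero N) e2).symm

/-- Invariance of the residue of `f / X^(N+1)` under the substitution `χ`. Splitting off the
constant term of `f` leaves a factor `χ`, which absorbs one `h` into `X` and lowers `N`. -/
theorem coeff_subst_mul_derivative_mul_pow {χ h : PowerSeries ℂ} (h0 : constantCoeff χ = 0)
    (hχ : χ * h = X) (N : ℕ) (f : PowerSeries ℂ) :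
    coeff N (f.subst χ * d⁄dX ℂ χ * h ^ (N + 1)) = coeff N f := by
  have hs : HasSubst χ := HasSubst.of_constantCoeff_zero' h0
  induction N generalizing f with
  | zero =>
    rw [mul_assoc, coeff_mul, Finset.Nat.antidiagonal_zero, Finset.sum_singleton,
      coeff_derivative_mul_pow h0 hχ, if_pos rfl, mul_one]
    conv_lhs => rw [eq_X_mul_shift_add_const f, subst_add hs, subst_mul hs, subst_X hs, subst_C]
    have : (MvPowerSeries.C (constantCoeff f) : MvPowerSeries Unit ℂ) =
      C (constantCoeff f) := rfl
    rw [this]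
    simp [h0]
  | succ N ih =>
    have hf : f.subst χ = χ * (mk fun p => coeff (p + 1) f).subst χ + C (constantCoeff f) := by
      conv_lhs => rw [eq_X_mul_shift_add_const f, subst_add hs, subst_mul hs, subst_X hs, subst_C]
      rfl
    have e : f.subst χ * d⁄dX ℂ χ * h ^ (N + 1 + 1) =
        X * ((mk fun p => coeff (p + 1) f).subst χ * d⁄dX ℂ χ * h ^ (N + 1)) +
          C (constantCoeff f) * (d⁄dX ℂ χ * h ^ (N + 1 + 1)) := by
      rw [hf, ← hχ]
      ring
    rw [e, map_add, coeff_succ_X_mul, ih, coeff_C_mul, coeff_derivative_mul_pow h0 hχ,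
      if_neg (Nat.succ_ne_zero N), mul_zero, add_zero, coeff_mk]

/-- Lagrange inversion. -/
theorem coeff_mul_eq_of_subst_eq_X {ψ χ h : PowerSeries ℂ} (h0 : constantCoeff χ = 0)
    (hψ : ψ.subst χ = X) (hχ : χ * h = X) (N : ℕ) :
    coeff (N + 1) ψ * (N + 1) = coeff N (h ^ (N + 1)) := by
  have hs : HasSubst χ := HasSubst.of_constantCoeff_zero' h0
  have hd := derivative_subst (f := ψ) hs
  rw [hψ, derivative_X] at hd
  -- Residue invariance is applied to `f = ψ'`, for which the chain rule gives `ψ'(χ) χ' = 1`.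
  rw [← coeff_derivative, ← coeff_subst_mul_derivative_mul_pow h0 hχ, ← hd, one_mul]

end Lagrange

/-! ### Moments and cumulants of free unitary Brownian motion. -/

section BrownianMoments

open PowerSeries

theorem coeff_one_add_X_mul_exp_pow (t : ℂ) (N : ℕ) :
    coeff N (((1 + X) * rescale (-t) (exp ℂ)) ^ (N + 1)) =
      ∑ j ∈ Finset.range (N + 1),
        ((N + 1).choose (j + 1) : ℂ) * ((-((N : ℂ) + 1) * t) ^ j / (j.factorial : ℂ)) := by
  have h1 : ∀ i, coeff i ((1 + X : PowerSeries ℂ) ^ (N + 1)) = ((N + 1).choose i : ℂ) := by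
    intro i
    rw [← Polynomial.coeff_one_add_X_pow ℂ (N + 1) i, ← Polynomial.coeff_coe]
    simp
  rw [mul_pow, ← map_pow, exp_pow_eq_rescale_exp, rescale_rescale, coeff_mul,
    Finset.Nat.sum_antidiagonal_eq_sum_range_succ_mk,
    -- After reflection `j` is the degree taken from the exponential, and the binomial `N + 1` over
    -- `N - j` becomes `N + 1` over `j + 1`.
    ← Finset.sum_range_reflect]
  refine Finset.sum_congr rfl fun j hj => ?_
  have hj' : j ≤ N := Nat.lt_succ_iff.1 (Finset.mem_range.1 hj)
  have e1 : N + 1 - 1 - j = N - j := by omega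
  have e2 : N - (N - j) = j := by omega
  have e3 : N - j = N + 1 - (j + 1) := by omega
  simp only [e1, e2, h1, coeff_rescale, coeff_exp]
  rw [e3, Nat.choose_symm (by omega)]
  simp only [eq_ratCast, Rat.cast_div, Rat.cast_one, Rat.cast_natCast]
  push_cast
  ring

/-- Multiplication by `n = N + 1` absorbs the sign and the exponent `j - 1`, since `-(-n)^(j-1) * n
= (-n)^j`, including the negative exponent at `j = 0`. -/
theorem aeval_polyQ (t y : ℂ) (N : ℕ) :
    MvPolynomial.aeval ![t, y] (polyQ (N + 1)) * ((N : ℂ) + 1) =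
      ∑ j ∈ Finset.range (N + 1),
        ((N + 1).choose (j + 1) : ℂ) * ((-((N : ℂ) + 1) * t) ^ j / (j.factorial : ℂ)) := by
  have hN : (N : ℂ) + 1 ≠ 0 := Nat.cast_add_one_ne_zero N
  rw [polyQ, map_neg, map_sum, neg_mul, Finset.sum_mul, ← Finset.sum_neg_distrib]
  refine Finset.sum_congr rfl fun j _ => ?_
  simp only [map_mul, MvPolynomial.aeval_C, map_pow, MvPolynomial.aeval_X, Matrix.cons_val_zero]
  rw [eq_ratCast]
  push_cast
  rw [zpow_sub_one₀ (neg_ne_zero.2 hN), zpow_natCast, mul_pow]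
  field_simp

variable {A : Type*} [Ring A] [Algebra ℂ A]

/-- The moments of an element whose `S`-transform is `e^{tz}`. -/
theorem moment_of_hasSTransform (φ : A →ₗ[ℂ] ℂ) (v : A) (t y : ℂ)
    (h : HasSTransform φ v (rescale t (exp ℂ))) (n : ℕ) (hn : n ≠ 0) :
    φ (v ^ n) = MvPolynomial.aeval ![t, y] (polyQ n) := by
  obtain ⟨-, χ, h0, hψ, hS⟩ := h
  obtain ⟨N, rfl⟩ := Nat.exists_eq_succ_of_ne_zero hn
  -- From `χ (1 + X) = X e^{tX}`, the series `X / χ` needed for Lagrange inversion is `(1 + X)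
  -- e^{-tX}`.
  have hχ : χ * ((1 + X) * rescale (-t) (exp ℂ)) = X := by
    rw [← mul_assoc, ← hS, mul_assoc, exp_mul_exp_eq_exp_add, add_neg_cancel]
    simp
  have hL := coeff_mul_eq_of_subst_eq_X h0 hψ hχ N
  rw [coeff_one_add_X_mul_exp_pow, ← aeval_polyQ t y] at hL
  have := mul_right_cancel₀ (Nat.cast_add_one_ne_zero N) hL
  rw [← this, momentSeries, coeff_mk, if_neg (Nat.succ_ne_zero N)]

variable [StarRing A] [StarModule ℂ A]

/-- Polarization: `φ` is real on `(1 + a)* (1 + a)`, so the imaginary parts of `φ a` and `φ (star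
a)` cancel. The same for `i a` matches the real parts. -/
theorem IsStarProbabilitySpace.map_star {φ : A →ₗ[ℂ] ℂ} (h : IsStarProbabilitySpace φ) (a : A) :
    φ (star a) = star (φ a) := by
  have key : ∀ a : A, (φ a).im + (φ (star a)).im = 0 := by
    intro a
    have h1 := h.im_eq_zero (1 + a)
    have e : star (1 + a) * (1 + a) = 1 + a + star a + star a * a := by
      rw [star_add, star_one]
      noncomm_ring
    rw [e, map_add, map_add, map_add, h.map_one, Complex.add_im, Complex.add_im, Complex.add_im,
      h.im_eq_zero a] at h1
    simpa using h1
  have h1 := key a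
  have h2 := key (Complex.I • a)
  rw [star_smul, map_smul, map_smul] at h2
  simp at h2
  refine Complex.ext ?_ ?_
  · simp
    linarith
  · simp
    linarith

theorem IsFreeUnitaryBrownianMotion.moment {A : ℝ≥0 → Type*} [∀ t, Ring (A t)]
    [∀ t, Algebra ℂ (A t)] [∀ t, StarRing (A t)] [∀ t, StarModule ℂ (A t)]
    {φ : ∀ t, A t →ₗ[ℂ] ℂ} {u : ∀ t, A t} (h : IsFreeUnitaryBrownianMotion φ u) (t : ℝ≥0)
    (j : ℤ) :
    φ t (((⟨u t, h.unitary t⟩ : _root_.unitary (A t)) ^ j : _root_.unitary (A t)) : A t) =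
      MvPolynomial.aeval ![((t : ℝ) : ℂ), (Real.exp (-(t : ℝ) / 2) : ℂ)] (polyMoment j) := by
  have hpos : ∀ n : ℕ, n ≠ 0 → φ t (u t ^ n) =
      MvPolynomial.aeval ![((t : ℝ) : ℂ), (Real.exp (-(t : ℝ) / 2) : ℂ)]
        (polyQ n * MvPolynomial.X 1 ^ n) := by
    intro n hn
    have h1 := moment_of_hasSTransform (φ t) _ ((t : ℝ) : ℂ) (Real.exp (-(t : ℝ) / 2) : ℂ)
      (h.sTransform t) n hn
    rw [map_mul, ← h1, smul_pow, map_smul, smul_eq_mul, map_pow (MvPolynomial.aeval _),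
      MvPolynomial.aeval_X]
    have h2 : ((Real.exp ((t : ℝ) / 2) : ℂ)) * (Real.exp (-(t : ℝ) / 2) : ℂ) = 1 := by
      rw [← Complex.ofReal_mul, ← Real.exp_add]
      ring_nf
      simp
    have h3 := congrArg (· ^ n) h2
    simp only [mul_pow, one_pow] at h3
    simp only [Matrix.cons_val_one, Matrix.cons_val_fin_one]
    linear_combination (-φ t (u t ^ n)) * h3
  have hreal : ∀ p : MvPolynomial (Fin 2) ℚ,
      star (MvPolynomial.aeval ![((t : ℝ) : ℂ), (Real.exp (-(t : ℝ) / 2) : ℂ)] p) =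
        MvPolynomial.aeval ![((t : ℝ) : ℂ), (Real.exp (-(t : ℝ) / 2) : ℂ)] p := by
    intro p
    induction p using MvPolynomial.induction_on with
    | C a => simp
    | add p q hp hq => rw [map_add, star_add, hp, hq]
    | mul_X p i hp =>
      rw [map_mul, star_mul', hp, MvPolynomial.aeval_X]
      fin_cases i <;> simp [-Complex.ofReal_exp]
  rcases eq_or_ne j 0 with rfl | hj
  · simp [polyMoment, (h.isStarProbabilitySpace t).map_one]
  have hn : j.natAbs ≠ 0 := Int.natAbs_ne_zero.2 hj
  rw [polyMoment, if_neg hj]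
  rcases Int.natAbs_eq j with hj' | hj'
  · rw [← hpos _ hn]
    conv_lhs => rw [hj', zpow_natCast]
    rfl
  -- A negative power is the adjoint of a positive one, whose moment is real because the polynomial
  -- has rational coefficients and is evaluated at real points.
  · rw [← hreal, ← hpos _ hn, ← (h.isStarProbabilitySpace t).map_star]
    conv_lhs => rw [hj', zpow_neg, zpow_natCast]
    rfl

theorem IsFreeUnitaryBrownianMotion.freeCumulant_eq {A : ℝ≥0 → Type*} [∀ t, Ring (A t)]
    [∀ t, Algebra ℂ (A t)] [∀ t, StarRing (A t)] [∀ t, StarModule ℂ (A t)]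
    {φ : ∀ t, A t →ₗ[ℂ] ℂ} {u : ∀ t, A t} (h : IsFreeUnitaryBrownianMotion φ u)
    (ω : List Symb) (t : ℝ≥0) :
    freeCumulant (φ t) (stringPow (u t) ω) =
      MvPolynomial.aeval ![((t : ℝ) : ℂ), (Real.exp (-(t : ℝ) / 2) : ℂ)] (polyZ ω) := by
  have h1 := freeCumulant_stringPow (φ t) ⟨u t, h.unitary t⟩ ω
  rw [polyZ_eq, ← AlgHom.coe_toRingHom, map_moebiusSum]
  simp only [h.moment] at h1
  exact h1

end BrownianMoments

/-! ### Algebraic independence of `t` and `e^{-t/2}`. -/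

section Uniqueness

/-- The functions `t` and `e^{-t/2}` on `[0, ∞)` are algebraically independent. -/
theorem eq_zero_of_aeval_exp_eq_zero (D : MvPolynomial (Fin 2) ℚ)
    (hD : ∀ t : ℝ≥0,
      MvPolynomial.aeval ![((t : ℝ) : ℂ), (Real.exp (-(t : ℝ) / 2) : ℂ)] D = 0) : D = 0 := by
  have han : AnalyticOnNhd ℂ
      (fun z : ℂ => MvPolynomial.aeval ![z, Complex.exp (-z / 2)] D) Set.univ := by
    refine AnalyticOnNhd.aeval_mvPolynomial (fun i => ?_) D
    fin_cases i
    · exact analyticOnNhd_id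
    · exact (analyticOnNhd_id.neg.mul (analyticOnNhd_const (v := (2 : ℂ)⁻¹))).cexp
  -- The reals near 1 are positive, so they are zeros of this entire function accumulating at 1; the
  -- identity theorem then makes it vanish everywhere.
  have hfreq : ∃ᶠ z in nhdsWithin (1 : ℂ) {1}ᶜ,
      MvPolynomial.aeval ![z, Complex.exp (-z / 2)] D = 0 := by
    have ht : Filter.Tendsto (fun x : ℝ => (x : ℂ)) (nhdsWithin 1 {1}ᶜ)
        (nhdsWithin (1 : ℂ) {1}ᶜ) := by
      refine tendsto_nhdsWithin_iff.2 ⟨?_, ?_⟩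
      · exact (Complex.continuous_ofReal.tendsto' 1 1 (by simp)).mono_left nhdsWithin_le_nhds
      · filter_upwards [self_mem_nhdsWithin] with x hx
        simpa using hx
    refine ht.frequently (Filter.Eventually.frequently ?_)
    filter_upwards [nhdsWithin_le_nhds (lt_mem_nhds (zero_lt_one (α := ℝ)))] with x hx
    obtain ⟨t, rfl⟩ : ∃ t : ℝ≥0, (t : ℝ) = x := ⟨⟨x, hx.le⟩, rfl⟩
    simpa using hD t
  have hz := han.eqOn_zero_of_preconnected_of_frequently_eq_zero isPreconnected_univ
    (Set.mem_univ 1) hfreq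
  have hxy : ∀ x y : ℂ, y ≠ 0 → MvPolynomial.aeval ![x, y] D = 0 := by
    intro x y hy
    set q : Polynomial ℂ := MvPolynomial.aeval ![Polynomial.X, Polynomial.C y] D with hq
    have hev : ∀ z : ℂ, q.eval z = MvPolynomial.aeval ![z, y] D := by
      intro z
      rw [hq, ← Polynomial.coe_evalRingHom, MvPolynomial.map_aeval, MvPolynomial.aeval_def,
        MvPolynomial.coe_eval₂Hom]
      congr 1
      · exact Subsingleton.elim _ _
      · funext i
        fin_cases i <;> simp
    have hq0 : q = 0 := by
      refine Polynomial.eq_zero_of_infinite_isRoot q ?_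
      -- At these points `e^{-z/2}` takes the fixed value `y`, so the one-variable polynomial `D(·,
      -- y)` has infinitely many roots.
      have hinj : Function.Injective fun k : ℕ =>
          -2 * (Complex.log y + k * (2 * Real.pi * Complex.I)) := by
        intro k l hkl
        have hpi : (2 * Real.pi * Complex.I : ℂ) ≠ 0 := Complex.two_pi_I_ne_zero
        have := add_left_cancel (mul_left_cancel₀ (by norm_num) hkl)
        exact_mod_cast mul_right_cancel₀ hpi this
      refine (Set.infinite_range_of_injective hinj).mono ?_
      rintro _ ⟨k, rfl⟩
      have h1 := hz (Set.mem_univ (-2 * (Complex.log y + k * (2 * Real.pi * Complex.I))))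
      have h2 : Complex.exp (-(-2 * (Complex.log y + k * (2 * Real.pi * Complex.I))) / 2) = y := by
        rw [show -(-2 * (Complex.log y + k * (2 * Real.pi * Complex.I))) / 2 =
          Complex.log y + k * (2 * Real.pi * Complex.I) by ring, Complex.exp_add,
          Complex.exp_nat_mul_two_pi_mul_I, mul_one, Complex.exp_log hy]
      simp only [h2] at h1
      exact (hev _).trans h1
    rw [← hev, hq0, Polynomial.eval_zero]
  -- The factor `X 1` covers the line `y = 0`, which the exponential never reaches, and is cancelled
  -- afterwards.
  have hmap : MvPolynomial.X 1 * MvPolynomial.map (algebraMap ℚ ℂ) D = 0 := by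
    refine MvPolynomial.funext fun s => ?_
    rw [map_mul, MvPolynomial.eval_X, map_zero, MvPolynomial.eval_map, ← MvPolynomial.aeval_def]
    by_cases h1 : s 1 = 0
    · rw [h1, zero_mul]
    · have : s = ![s 0, s 1] := by
        funext i
        fin_cases i <;> rfl
      rw [this, hxy _ _ h1, mul_zero]
  have hX : (MvPolynomial.X 1 : MvPolynomial (Fin 2) ℂ) ≠ 0 := MvPolynomial.X_ne_zero 1
  have h0 := (mul_eq_zero.1 hmap).resolve_left hX
  exact MvPolynomial.map_injective _ (algebraMap ℚ ℂ).injective (by rw [h0, map_zero])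

end Uniqueness

end FreeCumulants

/-- First part: the quadratic recursion for the joint free cumulants of `u` and `u*`, for every
unitary `u` in a `*`-probability space. Second part: `Z_ω` is the one and only polynomial in
`ℚ[x, y]` with `κ_n(u_t^{ω(1)}, …, u_t^{ω(n)}) = Z_ω(t, e^{-t/2})` for all `t ≥ 0`, where
`(u_t)` is a free unitary Brownian motion. Third part: the quadratic recursion for the
polynomials `Z_ω`. -/
theorem proposition3p4 :
    (∀ {A : Type*} [Ring A] [Algebra ℂ A] [StarRing A] [StarModule ℂ A]
        (φ : A →ₗ[ℂ] ℂ) (_ : FreeCumulants.IsStarProbabilitySpace φ)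
        (u : A) (_ : u ∈ unitary A)
        (n : ℕ) (_ : 3 ≤ n) (ω : List FreeCumulants.Symb) (_ : ω.length = n)
        (_ : ω.head? = some FreeCumulants.Symb.one)
        (_ : ω.getLast? = some FreeCumulants.Symb.star),
        FreeCumulants.freeCumulant φ (FreeCumulants.stringPow u ω) =
          -∑ m ∈ Finset.Icc 1 (n - 1),
            FreeCumulants.freeCumulant φ (FreeCumulants.stringPow u (ω.take m)) *
              FreeCumulants.freeCumulant φ (FreeCumulants.stringPow u (ω.drop m))) ∧
    (∀ {A : ℝ≥0 → Type*} [∀ t, Ring (A t)] [∀ t, Algebra ℂ (A t)] [∀ t, StarRing (A t)]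
        [∀ t, StarModule ℂ (A t)]
        (φ : ∀ t, A t →ₗ[ℂ] ℂ) (u : ∀ t, A t)
        (_ : FreeCumulants.IsFreeUnitaryBrownianMotion φ u)
        (ω : List FreeCumulants.Symb) (_ : ω ≠ []) (P : MvPolynomial (Fin 2) ℚ),
        (∀ t : ℝ≥0, FreeCumulants.freeCumulant (φ t) (FreeCumulants.stringPow (u t) ω) =
          MvPolynomial.aeval ![((t : ℝ) : ℂ), (Real.exp (-(t : ℝ) / 2) : ℂ)] P) ↔
        P = FreeCumulants.polyZ ω) ∧
    (∀ (n : ℕ) (_ : 3 ≤ n) (ω : List FreeCumulants.Symb) (_ : ω.length = n)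
        (_ : ω.head? = some FreeCumulants.Symb.one)
        (_ : ω.getLast? = some FreeCumulants.Symb.star),
        FreeCumulants.polyZ ω =
          -∑ m ∈ Finset.Icc 1 (n - 1),
            FreeCumulants.polyZ (ω.take m) * FreeCumulants.polyZ (ω.drop m)) := by
  refine ⟨?_, ?_, FreeCumulants.polyZ_recursion⟩
  · intro A _ _ _ _ φ hφ u hu n hn ω hlen hhead hlast
    exact FreeCumulants.freeCumulant_recursion φ hφ.map_one u hu n hn ω hlen hhead hlast
  · intro A _ _ _ _ φ u h ω _ P
    constructor
    · intro hP
      refine sub_eq_zero.1 (FreeCumulants.eq_zero_of_aeval_exp_eq_zero _ fun t => ?_)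
      rw [map_sub, ← hP t, h.freeCumulant_eq ω t, sub_self]
    · rintro rfl t
      exact h.freeCumulant_eq ω t
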